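/- **First-order safety games.** Let a finite set of state predicates with arities and a finite set $\mathcal C$ of constants (globally free variables) be given. A *first-order safety game* consists of a finite control-flow graph $(V,E,v_0)$, a first-order formula $\mathsf{Init}$ and, for each $v\in V$, a first-order formula $I[v]$ (both over the state predicates, with free variables from $\mathcal C$). Each edge $e=(v,\theta,v')$ belongs to one of two players, the reachability player $\mathcal A$ or the safety player $\mathcal B$, and uses at most one input predicate, private to $e$, which is controlled by the owner of $e$. The substitution $\theta$ assigns to each state predicate $R$ of arity $r$ a first-order formula $R\theta$ over the state predicates and the input predicate of $e$ (if any), with free variables from $\mathcal C$ and formal parameters $y_1,\dots,y_r$. All formulas may contain equalities and disequalities. Player $\mathcal A$ chooses a non-empty universe $U$ (finite or infinite), a valuation $\rho:\mathcal C\to U$, an initial state (interpretation of the state predicates over $U$) satisfying $\mathsf{Init}$ at $v_0$, and then repeatedly an outgoing edge; the owner of the edge chooses the value of its input predicate (if there is one), and in the new state each $R$ holds of $\bar u$ iff $R\theta$ holds at $\bar y=\bar u$ in the old state. A strategy for $\mathcal B$ chooses, from $U$, $\rho$, the play so far and the next edge, the input predicate at the edges of $\mathcal B$; it is winning if every finite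 play conforming to it ends in a pair $(v,s)$ with $s,\rho\models I[v]$. The game is *safe* if $\mathcal B$ has a winning strategy. The game is *monadic* if all predicates have arity at most $1$. **Weakest preconditions.** For an edge $e=(v,\theta,v')$ let $[\![e]\!]^\top\Psi$ be $\Psi\theta$ (each atom $R\bar t$ is replaced, without capture, by $(R\theta)[\bar t/\bar y]$), prefixed by universal (if $e$ belongs to $\mathcal A$) or existential (if $e$ belongs to $\mathcal B$) second-order quantification over the input predicate of $e$, if there is one. Put $$\Psi^{(0)}[v]=I[v],\qquad \Psi^{(h+1)}[v]=\Psi^{(h)}[v]\wedge\bigwedge_{e=(v,\theta,v')\in E}[\![e]\!]^\top\big(\Psi^{(h)}[v']\big).$$ **Theorem.** (1) For every monadic first-order safety game in which neither player controls any predicate (no edge has an input predicate), there is $h\ge 0$ such that for all $v\in V$ the formulas $\Psi^{(h)}[v]$ and $\Psi^{(h+1)}[v]$ are logically equivalent, i.e. have the same truth value over all non-empty universes, for all valuations of $\mathcal C$ and in all states. (2) Safety of such games is decidable: there is an algorithm which, given (a finite description of) a monadic first-order safety game in which neither player controls any predicate, decides whether the game is safe. -/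

import Mathlib

universe u

namespace FOGame

/-- A finite relational vocabulary: finitely many state predicates with their arities, and finitely
many constants (the globally free first-order variables). -/
structure Signature where
  numState : ℕ
  arity : Fin numState → ℕ
  numConst : ℕ

/-- First-order terms with `n` first-order variables in scope: a constant or a variable. -/
abbrev Tm (S : Signature) (n : ℕ) : Type := Fin S.numConst ⊕ Fin n

/-- Predicate variables of arity `r` in a context `Γ` (the list of the arities of the predicate
variables that are in scope, the innermost one first). -/
inductive PVar : List ℕ → ℕ → Type
  | zero {Γ : List ℕ} {r : ℕ} : PVar (r :: Γ) r
  | succ {Γ : List ℕ} {r q : ℕ} : PVar Γ r → PVar (q :: Γ) r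

/-- Second-order formulas with equality over the vocabulary `S`, with predicate variables from `Γ`
and `n` first-order variables in scope. Variables are de Bruijn indices, `0` being the innermost.
Input predicates of a game occur as predicate variables. -/
inductive Fml (S : Signature) : List ℕ → ℕ → Type
  | tru {Γ : List ℕ} {n : ℕ} : Fml S Γ n
  | state {Γ : List ℕ} {n : ℕ} (R : Fin S.numState) (ts : Fin (S.arity R) → Tm S n) : Fml S Γ n
  | pvar {Γ : List ℕ} {n r : ℕ} (X : PVar Γ r) (ts : Fin r → Tm S n) : Fml S Γ n
  | eq {Γ : List ℕ} {n : ℕ} (t t' : Tm S n) : Fml S Γ n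
  | neg {Γ : List ℕ} {n : ℕ} (φ : Fml S Γ n) : Fml S Γ n
  | and {Γ : List ℕ} {n : ℕ} (φ ψ : Fml S Γ n) : Fml S Γ n
  | all {Γ : List ℕ} {n : ℕ} (φ : Fml S Γ (n + 1)) : Fml S Γ n
  | allP {Γ : List ℕ} {n : ℕ} (r : ℕ) (φ : Fml S (r :: Γ) n) : Fml S Γ n

/-- States over the universe `U`: an interpretation of all state predicates. -/
abbrev State (S : Signature) (U : Type u) : Type u :=
  ∀ R : Fin S.numState, (Fin (S.arity R) → U) → Prop

/-- Valuations over the universe `U` of the predicate variables of the context `Γ`. -/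
abbrev PVal (U : Type u) (Γ : List ℕ) : Type u := ∀ r : ℕ, PVar Γ r → (Fin r → U) → Prop

/-- Extension of a valuation by a relation for a new innermost predicate variable. -/
def PVal.cons {U : Type u} {Γ : List ℕ} {q : ℕ} (B : (Fin q → U) → Prop) (ω : PVal U Γ) :
    PVal U (q :: Γ)
  | _, PVar.zero => B
  | r, PVar.succ X => ω r X

/-- The valuation of the empty context. -/
def PVal.nil {U : Type u} : PVal U [] := fun _ X => nomatch X

namespace Fml

variable {S : Signature}

/-- `φ.Holds ρ s ω v` : the formula `φ` is true in the state `s` under the valuation `ρ` of the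
constants, `ω` of the predicate variables and `v` of the first-order variables. -/
def Holds {U : Type u} (ρ : Fin S.numConst → U) (s : State S U) :
    {Γ : List ℕ} → {n : ℕ} → Fml S Γ n → PVal U Γ → (Fin n → U) → Prop
  | _, _, tru, _, _ => True
  | _, _, state R ts, _, v => s R fun i => Sum.elim ρ v (ts i)
  | _, _, pvar X ts, ω, v => ω _ X fun i => Sum.elim ρ v (ts i)
  | _, _, eq t t', _, v => Sum.elim ρ v t = Sum.elim ρ v t'
  | _, _, neg φ, ω, v => ¬ φ.Holds ρ s ω v
  | _, _, and φ ψ, ω, v => φ.Holds ρ s ω v ∧ ψ.Holds ρ s ω v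
  | _, _, all φ, ω, v => ∀ x : U, φ.Holds ρ s ω (Fin.cons x v)
  | _, _, allP r φ, ω, v => ∀ B : (Fin r → U) → Prop, φ.Holds ρ s (PVal.cons B ω) v

/-- First-order formulas: those without quantification over predicates. -/
def IsFO : {Γ : List ℕ} → {n : ℕ} → Fml S Γ n → Prop
  | _, _, tru => True
  | _, _, state _ _ => True
  | _, _, pvar _ _ => True
  | _, _, eq _ _ => True
  | _, _, neg φ => φ.IsFO
  | _, _, and φ ψ => φ.IsFO ∧ ψ.IsFO
  | _, _, all φ => φ.IsFO
  | _, _, allP _ _ => False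

/-- Existential quantification over a predicate. -/
def exP {Γ : List ℕ} {n : ℕ} (r : ℕ) (φ : Fml S (r :: Γ) n) : Fml S Γ n := neg (allP r (neg φ))

/-- The conjunction of a list of formulas. -/
def conj {Γ : List ℕ} {n : ℕ} : List (Fml S Γ n) → Fml S Γ n
  | [] => tru
  | φ :: l => and φ (conj l)

/-- A renaming of predicate variables, under one more binder. -/
def liftP {Γ Δ : List ℕ} {q : ℕ} (g : ∀ r, PVar Γ r → PVar Δ r) :
    ∀ r, PVar (q :: Γ) r → PVar (q :: Δ) r
  | _, PVar.zero => PVar.zero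
  | r, PVar.succ X => PVar.succ (g r X)

/-- A substitution of terms for first-order variables, under one more binder. -/
def liftT {m n : ℕ} (f : Fin m → Tm S n) : Fin (m + 1) → Tm S (n + 1) :=
  Fin.cons (Sum.inr 0) fun i => (f i).map id Fin.succ

/-- Simultaneous capture-avoiding renaming of the predicate variables along `g` and substitution of
the terms `f` for the first-order variables. -/
def inst : {Γ Δ : List ℕ} → {m n : ℕ} → (g : ∀ r, PVar Γ r → PVar Δ r) → (f : Fin m → Tm S n) →
    Fml S Γ m → Fml S Δ n
  | _, _, _, _, _, _, tru => tru
  | _, _, _, _, _, f, state R ts => state R fun i => Sum.elim Sum.inl f (ts i)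
  | _, _, _, _, g, f, pvar X ts => pvar (g _ X) fun i => Sum.elim Sum.inl f (ts i)
  | _, _, _, _, _, f, eq t t' => eq (Sum.elim Sum.inl f t) (Sum.elim Sum.inl f t')
  | _, _, _, _, g, f, neg φ => neg (φ.inst g f)
  | _, _, _, _, g, f, and φ ψ => and (φ.inst g f) (ψ.inst g f)
  | _, _, _, _, g, f, all φ => all (φ.inst g (liftT f))
  | _, _, _, _, g, f, allP r φ => allP r (φ.inst (liftP g) f)

end Fml

/-- Inclusion of predicate variables into a context that has been extended outside. -/
def PVar.left {Γ Δ : List ℕ} {r : ℕ} : PVar Γ r → PVar (Γ ++ Δ) r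
  | PVar.zero => PVar.zero
  | PVar.succ X => PVar.succ X.left

/-- Inclusion of predicate variables into a context that has been extended inside. -/
def PVar.right : (Γ : List ℕ) → {Δ : List ℕ} → {r : ℕ} → PVar Δ r → PVar (Γ ++ Δ) r
  | [], _, _, X => X
  | _ :: Γ, _, _, X => PVar.succ (PVar.right Γ X)

/-- The position of a predicate variable in its context. -/
def PVar.idx : {Γ : List ℕ} → {r : ℕ} → PVar Γ r → ℕ
  | _, _, PVar.zero => 0
  | _, _, PVar.succ X => X.idx + 1

/-- A substitution `{ R y₁ … y_r := θ R }` of formulas for all state predicates: the formal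
parameters are the first-order variables of `θ R`, and `Δ` lists the arities of the input predicates
which may occur in it. -/
abbrev Subst (S : Signature) (Δ : List ℕ) : Type := ∀ R : Fin S.numState, Fml S Δ (S.arity R)

/-- The formula `Ψθ`, obtained from `Ψ` by replacing each atom `R t₁ … t_r` by
`(θ R)[t₁ / y₁, …, t_r / y_r]`, without capture. -/
def Fml.subst {S : Signature} {Δ : List ℕ} (θ : Subst S Δ) :
    {Γ : List ℕ} → {n : ℕ} → Fml S Γ n → Fml S (Γ ++ Δ) n
  | _, _, tru => tru
  | Γ, _, state R ts => (θ R).inst (fun _ X => PVar.right Γ X) ts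
  | _, _, pvar X ts => pvar X.left ts
  | _, _, eq t t' => eq t t'
  | _, _, neg φ => neg (φ.subst θ)
  | _, _, and φ ψ => and (φ.subst θ) (ψ.subst θ)
  | _, _, all φ => all (φ.subst θ)
  | _, _, allP r φ => allP r (φ.subst θ)

/-- The two players: the reachability player `A` and the safety player `B`. -/
inductive Player
  | A
  | B

/-- An edge `(src, θ, tgt)` of the control-flow graph. Each edge carries at most one input
predicate, which is peculiar to it and under the control of the owner of the edge; `input` is its
arity, or `none` if the substitution uses no input predicate. -/
structure Edge (S : Signature) (numV : ℕ) where
  src : Fin numV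
  tgt : Fin numV
  owner : Player
  input : Option ℕ
  θ : Subst S input.toList
  θ_isFO : ∀ R, (θ R).IsFO

/-- A first-order safety game: a finite control-flow graph with a start point, an initial condition
`init` and an assertion `I`. -/
structure Game where
  sig : Signature
  numV : ℕ
  start : Fin numV
  numE : ℕ
  edge : Fin numE → Edge sig numV
  init : Fml sig [] 0
  init_isFO : init.IsFO
  I : Fin numV → Fml sig [] 0
  I_isFO : ∀ v, (I v).IsFO

/-- The successor state of `s` along an edge, for the valuation `ω` of its input predicate. -/
def Edge.next {S : Signature} {numV : ℕ} (e : Edge S numV) {U : Type u} (ρ : Fin S.numConst → U)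
    (ω : PVal U e.input.toList) (s : State S U) : State S U :=
  fun R y => (e.θ R).Holds ρ s ω y

/-- Quantification over the input predicate of an edge, if it has one: universal for the edges
of `A`, existential for those of `B`. -/
def quantifyInput {S : Signature} : Player → (o : Option ℕ) → Fml S o.toList 0 → Fml S [] 0
  | _, none, φ => φ
  | Player.A, some r, φ => Fml.allP r φ
  | Player.B, some r, φ => Fml.exP r φ

/-- The weakest precondition of `Ψ` with respect to an edge. -/
def Edge.wp {S : Signature} {numV : ℕ} (e : Edge S numV) (Ψ : Fml S [] 0) : Fml S [] 0 :=
  quantifyInput e.owner e.input (Ψ.subst e.θ)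

/-- Equivalence of closed formulas: the same truth value in all states over all (non-empty)
universes, under all valuations of the constants. -/
def Equivalent {S : Signature} (φ ψ : Fml S [] 0) : Prop :=
  ∀ (U : Type u) [Nonempty U] (ρ : Fin S.numConst → U) (s : State S U),
    φ.Holds ρ s PVal.nil Fin.elim0 ↔ ψ.Holds ρ s PVal.nil Fin.elim0

namespace Game

/-- The iteration of weakest preconditions,
`Ψ⁽⁰⁾[v] = I[v]` and `Ψ⁽ʰ⁺¹⁾[v] = Ψ⁽ʰ⁾[v] ∧ ⋀ { wp e (Ψ⁽ʰ⁾[v']) | e an edge from v to v' }`. -/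
def Psi (G : Game) : ℕ → Fin G.numV → Fml G.sig [] 0
  | 0, v => G.I v
  | h + 1, v => Fml.and (G.Psi h v) (Fml.conj
      (((List.finRange G.numE).filter fun e => (G.edge e).src = v).map
        fun e => (G.edge e).wp (G.Psi h (G.edge e).tgt)))

/-- The positions of a game over the universe `U`: a program point and a state. -/
abbrev Pos (G : Game) (U : Type u) : Type u := Fin G.numV × State G.sig U

/-- Strategies of the safety player: given the universe, the valuation of the constants, the play so
far (latest position first) and the next edge, a relation for the input predicate of that edge.
Only the values at edges of `B` matter. -/
abbrev Strategy (G : Game) : Type (u + 1) :=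
  ∀ (U : Type u) (_ : Fin G.sig.numConst → U) (_ : List (G.Pos U)) (e : Fin G.numE),
    PVal U (G.edge e).input.toList

/-- The plays (latest position first) which conform to the strategy `σ`: they start at the start
point in a state satisfying the initial condition, the edges and the input predicates at edges of `A`
are arbitrary, and the input predicates at edges of `B` are chosen by `σ`. -/
inductive Conforms (G : Game) (σ : Strategy.{u} G) {U : Type u} (ρ : Fin G.sig.numConst → U) :
    List (G.Pos U) → Prop
  | init (s : State G.sig U) (hs : G.init.Holds ρ s PVal.nil Fin.elim0) :
      Conforms G σ ρ [(G.start, s)]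
  | step (s : State G.sig U) (τ : List (G.Pos U)) (e : Fin G.numE)
      (ω : PVal U (G.edge e).input.toList) (hτ : Conforms G σ ρ (((G.edge e).src, s) :: τ))
      (hω : (G.edge e).owner = Player.B → ω = σ U ρ (((G.edge e).src, s) :: τ) e) :
      Conforms G σ ρ (((G.edge e).tgt, (G.edge e).next ρ ω s) :: ((G.edge e).src, s) :: τ)

/-- A strategy of the safety player is winning if every conforming play, over every non-empty
universe and for every valuation of the constants, ends in a position satisfying the assertion. -/
def Winning (G : Game) (σ : Strategy.{u} G) : Prop :=
  ∀ (U : Type u) [Nonempty U] (ρ : Fin G.sig.numConst → U) (v : Fin G.numV) (s : State G.sig U)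
    (τ : List (G.Pos U)), G.Conforms σ ρ ((v, s) :: τ) → (G.I v).Holds ρ s PVal.nil Fin.elim0

/-- The game is safe if the safety player has a winning strategy. -/
def Safe (G : Game) : Prop := ∃ σ : Strategy.{u} G, G.Winning σ

/-- All predicates are nullary or monadic. -/
def IsMonadic (G : Game) : Prop :=
  (∀ R, G.sig.arity R ≤ 1) ∧ ∀ e, ∀ r ∈ (G.edge e).input, r ≤ 1

/-- The given player controls no predicate. -/
def NoInputOf (G : Game) (p : Player) : Prop :=
  ∀ e, (G.edge e).owner = p → (G.edge e).input = none

end Game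

/-- Gödel numbers of terms. -/
def codeTm {S : Signature} {n : ℕ} : Tm S n → ℕ
  | Sum.inl c => 2 * c
  | Sum.inr i => 2 * i + 1

/-- Gödel numbers of lists of terms. -/
def codeTms {S : Signature} {n r : ℕ} (ts : Fin r → Tm S n) : ℕ :=
  Encodable.encode (List.ofFn fun i => codeTm (ts i))

/-- Gödel numbers of formulas. -/
def Fml.code {S : Signature} : {Γ : List ℕ} → {n : ℕ} → Fml S Γ n → ℕ
  | _, _, tru => 0
  | _, _, state R ts => Nat.pair 0 (Nat.pair R (codeTms ts)) + 1
  | _, _, pvar X ts => Nat.pair 1 (Nat.pair X.idx (codeTms ts)) + 1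
  | _, _, eq t t' => Nat.pair 2 (Nat.pair (codeTm t) (codeTm t')) + 1
  | _, _, neg φ => Nat.pair 3 φ.code + 1
  | _, _, and φ ψ => Nat.pair 4 (Nat.pair φ.code ψ.code) + 1
  | _, _, all φ => Nat.pair 5 φ.code + 1
  | _, _, allP r φ => Nat.pair 6 (Nat.pair r φ.code) + 1

/-- Codes of edges: source, target, whether the edge belongs to `B`, the arity of the input
predicate if there is one, and the Gödel numbers of the formulas of the substitution. -/
abbrev EdgeCode : Type := ℕ × ℕ × Bool × Option ℕ × List ℕ

/-- The code of an edge. -/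
def Edge.code {S : Signature} {numV : ℕ} (e : Edge S numV) : EdgeCode :=
  (e.src, e.tgt, (match e.owner with | Player.A => false | Player.B => true), e.input,
    List.ofFn fun R => (e.θ R).code)

/-- Finite descriptions of games, on which algorithms work: the arities of the state predicates, the
number of constants, the number of program points, the start point, the codes of the edges, of the
initial condition and of the assertion. -/
abbrev GameCode : Type := List ℕ × ℕ × ℕ × ℕ × List EdgeCode × ℕ × List ℕ

/-- The finite description of a game. -/
def Game.code (G : Game) : GameCode :=
  (List.ofFn G.sig.arity, G.sig.numConst, G.numV, G.start, List.ofFn fun e => (G.edge e).code,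
    G.init.code, List.ofFn fun v => (G.I v).code)

end FOGame

/-!
Without input predicates every play is determined by the structure that it starts from and by the
edges taken, so that the game is safe iff all iterated weakest preconditions hold at the start
(`Game.NoInput.safe_iff`). The theorem then follows from a small model property which is uniform in
the number of iterations.

Let `N` bound the quantifier ranks, including parameters, of the formulas occurring in the game. A
subset of the universe is an `N`-core (`IsCore`) if it contains, for each element outside of it, at
least `N` elements interchangeable with that element by an automorphism of the structure. Passing to
an `N`-core that contains the constants does not change the truth of formulas of rank at most `N`
(`IsCore.holds_iff`). The successor state along an edge is definable, so that automorphisms of a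
structure are automorphisms of all its successors. Hence an `N`-core remains an `N`-core along all
plays, and it has the same truth values as the whole structure for all iterated weakest
preconditions, although their ranks are unbounded (`IsCore.Psi_iff`).

For a monadic vocabulary, two elements that are not constants are interchangeable as soon as they
satisfy the same predicates. The constants together with at most `N` elements of each of the finitely
many types thus form an `N`-core of a size that does not depend on the structure (`exists_isCore`).
On universes of this size there are finitely many positions. The decreasing sequence of the sets of
positions satisfying the iterated weakest preconditions, each of which determines the next, is
therefore stable after a number of steps bounded by the number of positions
(`Game.Psi_of_stableBound`).

Both bounds are computable from the code of the game, whose Gödel number bounds the ranks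
(`Game.rankLE_code`). The decision procedure `decideSafe` enumerates the small structures and evaluates
the initial condition and the weakest precondition at the stable stage (`decideSafe_iff`). It is
primitive recursive, the evaluation of formulas being a recursion on Gödel numbers
(`primrec_evalCode`).
-/

namespace FOGame

open Function

/-! ### Semantics of substitutions and of weakest preconditions -/

theorem elim_elim_inl {S : Signature} {U : Type*} {m n : ℕ} (ρ : Fin S.numConst → U) (v : Fin n → U)
    (f : Fin m → Tm S n) (t : Tm S m) :
    Sum.elim ρ v (Sum.elim Sum.inl f t) = Sum.elim ρ (fun i => Sum.elim ρ v (f i)) t := by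
  cases t <;> rfl

theorem Fml.holds_inst {S : Signature} {U : Type*} (ρ : Fin S.numConst → U) (s : State S U)
    {Γ Δ : List ℕ} {m n : ℕ} (g : ∀ r, PVar Γ r → PVar Δ r) (f : Fin m → Tm S n) (φ : Fml S Γ m)
    (ω : PVal U Δ) (v : Fin n → U) :
    (φ.inst g f).Holds ρ s ω v ↔
      φ.Holds ρ s (fun r X => ω r (g r X)) fun i => Sum.elim ρ v (f i) := by
  induction φ generalizing Δ n with
  | tru => exact Iff.rfl
  | state R ts => simp only [inst, Holds, elim_elim_inl]
  | pvar X ts => simp only [inst, Holds, elim_elim_inl]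
  | eq t t' => simp only [inst, Holds, elim_elim_inl]
  | neg φ ih => simp only [inst, Holds, ih]
  | and φ ψ ih₁ ih₂ => simp only [inst, Holds, ih₁, ih₂]
  | all φ ih =>
    simp only [inst, Holds, ih]
    refine forall_congr' fun x => ?_
    have : (fun i => Sum.elim ρ (Fin.cons x v : Fin (n + 1) → U) (liftT f i)) =
        Fin.cons x fun i => Sum.elim ρ v (f i) := by
      funext i
      refine Fin.cases rfl (fun i => ?_) i
      simp only [liftT, Fin.cons_succ]
      cases f i <;> simp
    rw [this]
  | allP r φ ih =>
    simp only [inst, Holds, ih]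
    refine forall_congr' fun B => ?_
    have : (fun q X => PVal.cons B ω q (liftP g q X)) =
        PVal.cons B fun q X => ω q (g q X) := by
      funext q X
      cases X <;> rfl
    rw [this]

/-- Substitution lemma: `Ψθ` holds in a state iff `Ψ` holds in the state that `θ` computes from it. -/
theorem Fml.holds_subst {S : Signature} {U : Type*} (ρ : Fin S.numConst → U) (s : State S U)
    {Γ Δ : List ℕ} {n : ℕ} (θ : Subst S Δ) (φ : Fml S Γ n) (ω : PVal U (Γ ++ Δ)) (v : Fin n → U) :
    (φ.subst θ).Holds ρ s ω v ↔
      φ.Holds ρ (fun R y => (θ R).Holds ρ s (fun r X => ω r (PVar.right Γ X)) y)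
        (fun r X => ω r X.left) v := by
  induction φ with
  | tru => exact Iff.rfl
  | state R ts => simp only [subst, Holds, holds_inst]
  | pvar X ts => exact Iff.rfl
  | eq t t' => exact Iff.rfl
  | neg φ ih => simp only [subst, Holds, ih]
  | and φ ψ ih₁ ih₂ => simp only [subst, Holds, ih₁, ih₂]
  | all φ ih => simp only [subst, Holds, ih]
  | @allP Γ n r φ ih =>
    simp only [subst, Holds]
    refine forall_congr' fun B => ?_
    have h : (fun q X => PVal.cons B ω q (PVar.left X)) =
        PVal.cons B fun q X => ω q (PVar.left X) := by
      funext q X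
      cases X <;> rfl
    rw [← h]
    exact ih (PVal.cons B ω) v

theorem Fml.holds_conj {S : Signature} {U : Type*} (ρ : Fin S.numConst → U) (s : State S U)
    {Γ : List ℕ} {n : ℕ} (l : List (Fml S Γ n)) (ω : PVal U Γ) (v : Fin n → U) :
    (conj l).Holds ρ s ω v ↔ ∀ φ ∈ l, φ.Holds ρ s ω v := by
  induction l with
  | nil => simp [conj, Holds]
  | cons φ l ih => simp [conj, Holds, ih]

theorem PVal.eq_of_eq_nil {U : Type*} {Γ : List ℕ} (hΓ : Γ = []) (ω ω' : PVal U Γ) : ω = ω' := by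
  subst hΓ
  funext r X
  nomatch X

/-- Truth of a closed formula without free predicate variables. -/
abbrev Fml.IsTrue {S : Signature} {U : Type*} (φ : Fml S [] 0) (ρ : Fin S.numConst → U)
    (s : State S U) : Prop :=
  φ.Holds ρ s PVal.nil Fin.elim0

/-- The successor state along an edge that has no input predicate. The valuation of the predicate
variables is then immaterial, and the empty relations serve. -/
def Edge.succ {S : Signature} {numV : ℕ} (e : Edge S numV) {U : Type*} (ρ : Fin S.numConst → U)
    (s : State S U) : State S U :=
  e.next ρ (fun _ _ _ => False) s

theorem Edge.next_eq_succ {S : Signature} {numV : ℕ} {e : Edge S numV} (he : e.input = none)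
    {U : Type*} (ρ : Fin S.numConst → U) (ω : PVal U e.input.toList) (s : State S U) :
    e.next ρ ω s = e.succ ρ s := by
  rw [Edge.succ, PVal.eq_of_eq_nil (by simp [he]) ω]

theorem Edge.holds_wp {S : Signature} {numV : ℕ} {e : Edge S numV} (he : e.input = none)
    {U : Type*} (ρ : Fin S.numConst → U) (s : State S U) (Ψ : Fml S [] 0) :
    (e.wp Ψ).IsTrue ρ s ↔ Ψ.IsTrue ρ (e.succ ρ s) := by
  obtain ⟨src, tgt, owner, input, θ, hθ⟩ := e
  subst he
  have hq : quantifyInput owner none (Ψ.subst θ) = Ψ.subst θ := by cases owner <;> rfl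
  refine Iff.trans (iff_of_eq (congrArg (fun φ => Fml.IsTrue φ ρ s) hq)) ?_
  refine (Fml.holds_subst (Γ := []) ρ s θ Ψ PVal.nil Fin.elim0).trans (iff_of_eq ?_)
  congr 1
  · funext R y
    exact congrArg (fun ω => (θ R).Holds ρ s ω y) (PVal.eq_of_eq_nil rfl _ _)
  · exact PVal.eq_of_eq_nil rfl _ _

namespace Game

/-- No edge of the game has an input predicate. -/
def NoInput (G : Game) : Prop := ∀ e, (G.edge e).input = none

theorem noInput_of_noInputOf {G : Game} (hA : G.NoInputOf Player.A) (hB : G.NoInputOf Player.B) :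
    G.NoInput := by
  intro e
  cases h : (G.edge e).owner
  exacts [hA e h, hB e h]

theorem NoInput.holds_Psi_succ {G : Game} (hG : G.NoInput) {U : Type*}
    (ρ : Fin G.sig.numConst → U) (s : State G.sig U) (h : ℕ) (v : Fin G.numV) :
    (G.Psi (h + 1) v).IsTrue ρ s ↔ (G.Psi h v).IsTrue ρ s ∧
      ∀ e, (G.edge e).src = v → (G.Psi h (G.edge e).tgt).IsTrue ρ ((G.edge e).succ ρ s) := by
  simp only [Psi, Fml.Holds, Fml.holds_conj, List.mem_map, List.mem_filter, List.mem_finRange,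
    true_and, decide_eq_true_eq, forall_exists_index, and_imp, forall_apply_eq_imp_iff₂]
  exact and_congr_right fun _ => forall₂_congr fun e _ => Edge.holds_wp (hG e) ρ s _

/-- Without input predicates the plays do not depend on the strategy of the safety player, so that
the game is safe iff all weakest preconditions hold at the start. -/
theorem NoInput.safe_iff {G : Game} (hG : G.NoInput) :
    Safe.{u} G ↔ ∀ (U : Type u) [Nonempty U] (ρ : Fin G.sig.numConst → U) (s : State G.sig U),
      G.init.IsTrue ρ s → ∀ h, (G.Psi h G.start).IsTrue ρ s := by
  constructor
  · rintro ⟨σ, hσ⟩ U _ ρ s hs h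
    suffices H : ∀ h v s τ, G.Conforms σ ρ ((v, s) :: τ) → (G.Psi h v).IsTrue ρ s from
      H h _ s _ (.init s hs)
    intro h
    induction h with
    | zero => exact fun v s τ hτ => hσ U ρ v s τ hτ
    | succ h ih =>
      intro v s τ hτ
      rw [hG.holds_Psi_succ]
      refine ⟨ih v s τ hτ, ?_⟩
      rintro e rfl
      have := ih _ _ _ (Conforms.step s τ e (σ U ρ _ e) hτ fun _ => rfl)
      rwa [Edge.next_eq_succ (hG e)] at this
  · intro H
    refine ⟨fun _ _ _ _ _ _ _ => False, ?_⟩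
    intro U _ ρ v s τ hτ
    suffices h : ∀ l, G.Conforms (fun _ _ _ _ _ _ _ => False) ρ l →
        ∀ v s τ, l = (v, s) :: τ → ∀ h, (G.Psi h v).IsTrue ρ s from h _ hτ v s τ rfl 0
    intro l hl
    induction hl with
    | init s hs =>
      rintro v s' τ ⟨⟩
      exact H U ρ s hs
    | step s τ e ω hτ hω ih =>
      rintro v s' τ' ⟨⟩ h
      rw [Edge.next_eq_succ (hG e)]
      exact ((hG.holds_Psi_succ ρ s h _).1 (ih _ _ _ rfl (h + 1))).2 e rfl

end Game

/-! ### Invariance under automorphisms -/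

/-- `π` is an automorphism of the structure given by the constants and the state. -/
structure IsAut {S : Signature} {U : Type*} (ρ : Fin S.numConst → U) (s : State S U)
    (π : Equiv.Perm U) : Prop where
  const : ∀ c, π (ρ c) = ρ c
  state : ∀ R t, s R (π ∘ t) ↔ s R t

theorem apply_elim {S : Signature} {U W : Type*} {n : ℕ} {ρ : Fin S.numConst → U}
    {ρ' : Fin S.numConst → W} {f : U → W} (hf : ∀ c, f (ρ c) = ρ' c) (v : Fin n → U) (t : Tm S n) :
    f (Sum.elim ρ v t) = Sum.elim ρ' (f ∘ v) t := by
  cases t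
  exacts [hf _, rfl]

theorem IsAut.holds_iff {S : Signature} {U : Type*} {ρ : Fin S.numConst → U} {s : State S U}
    {π : Equiv.Perm U} (hπ : IsAut ρ s π) {Γ : List ℕ} {n : ℕ} (φ : Fml S Γ n) (hφ : φ.IsFO)
    (hΓ : Γ = []) (ω : PVal U Γ) (v : Fin n → U) :
    φ.Holds ρ s ω (π ∘ v) ↔ φ.Holds ρ s ω v := by
  have hv {n r : ℕ} (v : Fin n → U) (ts : Fin r → Tm S n) :
      (fun i => Sum.elim ρ (π ∘ v) (ts i)) = π ∘ fun i => Sum.elim ρ v (ts i) :=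
    funext fun i => (apply_elim hπ.const v (ts i)).symm
  induction φ with
  | tru => exact Iff.rfl
  | state R ts => simp only [Fml.Holds, hv, hπ.state]
  | pvar X ts => subst hΓ; nomatch X
  | eq t t' => simp only [Fml.Holds, ← apply_elim hπ.const, π.injective.eq_iff]
  | neg φ ih => simp only [Fml.Holds, ih hφ hΓ]
  | and φ ψ ih₁ ih₂ => simp only [Fml.Holds, ih₁ hφ.1 hΓ, ih₂ hφ.2 hΓ]
  | all φ ih =>
    simp only [Fml.Holds]
    -- Shifting the quantified element along `π` reduces the claim to the induction hypothesis.
    rw [← π.forall_congr_right]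
    refine forall_congr' fun x => ?_
    rw [← Fin.comp_cons]
    exact ih hφ hΓ ω (Fin.cons x v)
  | allP r φ ih => exact hφ.elim

theorem IsAut.succ {S : Signature} {numV : ℕ} {e : Edge S numV} (he : e.input = none)
    {U : Type*} {ρ : Fin S.numConst → U} {s : State S U} {π : Equiv.Perm U} (hπ : IsAut ρ s π) :
    IsAut ρ (e.succ ρ s) π :=
  ⟨hπ.const, fun R t => hπ.holds_iff (e.θ R) (e.θ_isFO R) (by simp [he]) _ t⟩

/-! ### Substructures which agree on formulas of small quantifier rank -/

/-- Quantifier rank with respect to first-order quantifiers. -/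
def Fml.rank {S : Signature} : {Γ : List ℕ} → {n : ℕ} → Fml S Γ n → ℕ
  | _, _, tru => 0
  | _, _, state _ _ => 0
  | _, _, pvar _ _ => 0
  | _, _, eq _ _ => 0
  | _, _, neg φ => φ.rank
  | _, _, and φ ψ => max φ.rank ψ.rank
  | _, _, all φ => φ.rank + 1
  | _, _, allP _ φ => φ.rank

/-- The restriction of a state along a map. -/
def State.comap {S : Signature} {U W : Type*} (f : W → U) (s : State S U) : State S W :=
  fun R t => s R (f ∘ t)

/-- The image of `f` is an `N`-core of the structure: each element outside of it is interchangeable,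
by an automorphism, with at least `N` elements of it. -/
structure IsCore {S : Signature} {U W : Type*} (N : ℕ) (f : W → U) (ρ : Fin S.numConst → U)
    (s : State S U) : Prop where
  injective : Injective f
  exists_swap : ∀ x ∉ Set.range f, ∃ Y : Finset W, N ≤ Y.card ∧
    ∀ y ∈ Y, ∀ [DecidableEq U], IsAut ρ s (Equiv.swap x (f y))

/-- Truth of a formula of rank `q` with `n` parameters in an `N`-core does not change on passing to
the core if `q + n ≤ N`: a witness outside of the core can be swapped with one of the `N` elements
of the core interchangeable with it which is not among the parameters. -/
theorem IsCore.holds_iff {S : Signature} {U W : Type*} {N : ℕ} {f : W → U} {ρ : Fin S.numConst → U}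
    {s : State S U} (hf : IsCore N f ρ s) {ρ' : Fin S.numConst → W} (hρ : ∀ c, f (ρ' c) = ρ c)
    {Γ : List ℕ} {n : ℕ} (φ : Fml S Γ n) (hφ : φ.IsFO) (hN : φ.rank + n ≤ N) (hΓ : Γ = [])
    (ω' : PVal W Γ) (ω : PVal U Γ) (v : Fin n → W) :
    φ.Holds ρ' (s.comap f) ω' v ↔ φ.Holds ρ s ω (f ∘ v) := by
  classical
  have hv {n r : ℕ} (v : Fin n → W) (ts : Fin r → Tm S n) :
      (fun i => Sum.elim ρ (f ∘ v) (ts i)) = f ∘ fun i => Sum.elim ρ' v (ts i) :=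
    funext fun i => (apply_elim hρ v (ts i)).symm
  induction φ with
  | tru => exact Iff.rfl
  | state R ts => simp only [Fml.Holds, hv, State.comap]
  | pvar X ts => subst hΓ; nomatch X
  | eq t t' => simp only [Fml.Holds, ← apply_elim hρ, hf.injective.eq_iff]
  | neg φ ih => simp only [Fml.Holds, ih hφ hN hΓ ω' ω]
  | and φ ψ ih₁ ih₂ =>
    simp only [Fml.rank] at hN
    simp only [Fml.Holds, ih₁ hφ.1 (by omega) hΓ ω' ω, ih₂ hφ.2 (by omega) hΓ ω' ω]
  | @all Γ n φ ih =>
    simp only [Fml.rank] at hN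
    have ih' := fun y => ih hφ (by omega) hΓ ω' ω (Fin.cons y v)
    simp only [Fin.comp_cons] at ih'
    simp only [Fml.Holds, ih']
    refine ⟨fun H x => ?_, fun H y => H (f y)⟩
    by_cases hx : x ∈ Set.range f
    · obtain ⟨y, rfl⟩ := hx
      exact H y
    obtain ⟨Y, hY, hswap⟩ := hf.exists_swap x hx
    obtain ⟨y, hyY, hyv⟩ : ∃ y ∈ Y, y ∉ Finset.univ.image v := by
      refine Finset.exists_mem_notMem_of_card_lt_card (lt_of_le_of_lt Finset.card_image_le ?_)
      simp only [Finset.card_univ, Fintype.card_fin]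
      omega
    have hfix : Equiv.swap x (f y) ∘ f ∘ v = f ∘ v := by
      funext i
      refine Equiv.swap_apply_of_ne_of_ne (fun h => hx ⟨v i, h⟩) fun h => ?_
      exact hyv (Finset.mem_image.2 ⟨i, Finset.mem_univ i, hf.injective h⟩)
    have := ((hswap y hyY).holds_iff φ hφ hΓ ω (Fin.cons (f y) (f ∘ v))).2 (H y)
    rwa [Fin.comp_cons, Equiv.swap_apply_right, hfix] at this
  | allP r φ ih => exact hφ.elim

theorem IsCore.succ {S : Signature} {numV N : ℕ} {e : Edge S numV} (he : e.input = none)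
    {U W : Type*} {f : W → U} {ρ : Fin S.numConst → U} {s : State S U} (hf : IsCore N f ρ s) :
    IsCore N f ρ (e.succ ρ s) := by
  refine ⟨hf.injective, fun x hx => ?_⟩
  obtain ⟨Y, hY, hswap⟩ := hf.exists_swap x hx
  exact ⟨Y, hY, fun y hy _ => (hswap y hy).succ he⟩

theorem IsCore.comap_succ {S : Signature} {numV N : ℕ} {e : Edge S numV} (he : e.input = none)
    (hN : ∀ R, (e.θ R).rank + S.arity R ≤ N)
    {U W : Type*} {f : W → U} {ρ : Fin S.numConst → U} {s : State S U} (hf : IsCore N f ρ s)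
    {ρ' : Fin S.numConst → W} (hρ : ∀ c, f (ρ' c) = ρ c) :
    (e.succ ρ s).comap f = e.succ ρ' (s.comap f) := by
  funext R t
  exact propext (hf.holds_iff hρ (e.θ R) (e.θ_isFO R) (hN R) (by simp [he]) _ _ t).symm

/-- `N` bounds the quantifier ranks, including parameters, of all formulas of the game. -/
structure Game.RankLE (G : Game) (N : ℕ) : Prop where
  θ : ∀ e R, ((G.edge e).θ R).rank + G.sig.arity R ≤ N
  init : G.init.rank ≤ N
  I : ∀ v, (G.I v).rank ≤ N

/-- A core for the ranks of the formulas of the game decides all iterated weakest preconditions,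
although their ranks grow: it remains a core along all plays. -/
theorem IsCore.Psi_iff {G : Game} {N : ℕ} (hG : G.NoInput) (hN : G.RankLE N)
    {U W : Type*} {f : W → U} {ρ : Fin G.sig.numConst → U} {s : State G.sig U}
    (hf : IsCore N f ρ s) {ρ' : Fin G.sig.numConst → W} (hρ : ∀ c, f (ρ' c) = ρ c)
    (h : ℕ) (v : Fin G.numV) :
    (G.Psi h v).IsTrue ρ' (s.comap f) ↔ (G.Psi h v).IsTrue ρ s := by
  induction h generalizing s v with
  | zero =>
    have := hf.holds_iff hρ (G.I v) (G.I_isFO v) (hN.I v) rfl PVal.nil PVal.nil Fin.elim0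
    rwa [Subsingleton.elim (f ∘ Fin.elim0) Fin.elim0] at this
  | succ h ih =>
    rw [hG.holds_Psi_succ, hG.holds_Psi_succ, ih hf]
    refine and_congr_right fun _ => forall₂_congr fun e _ => ?_
    rw [← hf.comap_succ (hG e) (hN.θ e) hρ, ih (hf.succ (hG e))]

theorem IsCore.init_iff {G : Game} {N : ℕ} (hN : G.RankLE N)
    {U W : Type*} {f : W → U} {ρ : Fin G.sig.numConst → U} {s : State G.sig U}
    (hf : IsCore N f ρ s) {ρ' : Fin G.sig.numConst → W} (hρ : ∀ c, f (ρ' c) = ρ c) :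
    G.init.IsTrue ρ' (s.comap f) ↔ G.init.IsTrue ρ s := by
  have := hf.holds_iff hρ G.init G.init_isFO hN.init rfl PVal.nil PVal.nil Fin.elim0
  rwa [Subsingleton.elim (f ∘ Fin.elim0) Fin.elim0] at this

theorem IsCore.of_bijective {S : Signature} {U W : Type*} (N : ℕ) {f : W → U} (hf : Bijective f)
    (ρ : Fin S.numConst → U) (s : State S U) : IsCore N f ρ s :=
  ⟨hf.1, fun x hx => (hx (hf.2 x)).elim⟩

theorem exists_eq_const {r : ℕ} (hr : r ≤ 1) {U : Type*} [Nonempty U] (t : Fin r → U) :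
    ∃ z, t = fun _ => z := by
  rcases isEmpty_or_nonempty (Fin r) with h | ⟨⟨i⟩⟩
  · exact ⟨Classical.arbitrary U, Subsingleton.elim _ _⟩
  · exact ⟨t i, funext fun j => congrArg t (Fin.ext (by omega))⟩

/-- Elements which are not constants and satisfy the same monadic state predicates are
interchangeable. -/
theorem isAut_swap {S : Signature} (hS : ∀ R, S.arity R ≤ 1) {U : Type*} [DecidableEq U]
    {ρ : Fin S.numConst → U} {s : State S U} {x y : U} (hx : x ∉ Set.range ρ)
    (hy : y ∉ Set.range ρ) (hxy : ∀ R, s R (fun _ => x) ↔ s R (fun _ => y)) :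
    IsAut ρ s (Equiv.swap x y) := by
  refine ⟨fun c => Equiv.swap_apply_of_ne_of_ne (fun h => hx ⟨c, h⟩) fun h => hy ⟨c, h⟩, ?_⟩
  intro R t
  have : Nonempty U := ⟨x⟩
  obtain ⟨z, rfl⟩ := exists_eq_const (hS R) t
  change s R (fun _ => Equiv.swap x y z) ↔ _
  by_cases hzx : z = x
  · rw [hzx, Equiv.swap_apply_left, hxy]
  by_cases hzy : z = y
  · rw [hzy, Equiv.swap_apply_right, hxy]
  rw [Equiv.swap_apply_of_ne_of_ne hzx hzy]

/-- Every structure over a monadic signature with `k` predicates has an `N`-core consisting of the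
constants and of at most `N` elements of each of the `2 ^ k` monadic types. -/
theorem exists_isCore {S : Signature} (hS : ∀ R, S.arity R ≤ 1) (N : ℕ) {U : Type*}
    (ρ : Fin S.numConst → U) (s : State S U) :
    ∃ m ≤ S.numConst + 2 ^ S.numState * N, ∃ (f : Fin m → U) (ρ' : Fin S.numConst → Fin m),
      (∀ c, f (ρ' c) = ρ c) ∧ IsCore N f ρ s := by
  classical
  -- `cls τ` consists of the elements of type `τ` which are not constants. It contributes to the core
  -- all of its elements, or `N` of them if there are more.
  let cls : (Fin S.numState → Prop) → Set U := fun τ =>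
    {x | x ∉ Set.range ρ ∧ (fun R => s R fun _ => x) = τ}
  have hA : ∀ τ, ∃ A : Finset U, ↑A ⊆ cls τ ∧ A.card ≤ N ∧ (cls τ ⊆ ↑A ∨ A.card = N) := by
    intro τ
    by_cases h : (cls τ).Finite ∧ (cls τ).ncard ≤ N
    · refine ⟨h.1.toFinset, by simp, ?_, Or.inl (by simp)⟩
      rw [← Set.ncard_eq_toFinset_card _ h.1]
      exact h.2
    · obtain ⟨A, hA, hc⟩ : ∃ A : Finset U, ↑A ⊆ cls τ ∧ A.card = N := by
        by_cases hfin : (cls τ).Finite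
        · have hlt : N ≤ hfin.toFinset.card := by
            rw [← Set.ncard_eq_toFinset_card _ hfin]
            by_contra hlt
            exact h ⟨hfin, by omega⟩
          obtain ⟨A, hA, hc⟩ := Finset.exists_subset_card_eq hlt
          exact ⟨A, fun x hx => hfin.mem_toFinset.1 (hA hx), hc⟩
        · exact Set.Infinite.exists_subset_card_eq hfin N
      exact ⟨A, hA, hc.le, Or.inr hc⟩
  choose A hAsub hAcard hA using hA
  let D : Finset U := Finset.univ.image ρ ∪ Finset.univ.biUnion A
  have hD : D.card ≤ S.numConst + 2 ^ S.numState * N := by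
    refine (Finset.card_union_le _ _).trans (add_le_add ?_ ?_)
    · exact Finset.card_image_le.trans (by simp)
    · refine (Finset.card_biUnion_le_card_mul _ _ N fun τ _ => hAcard τ).trans ?_
      simp
  let g : D ≃ Fin D.card := D.equivFin
  have hmem : ∀ c, ρ c ∈ D := fun c => by simp [D]
  refine ⟨D.card, hD, fun i => (g.symm i : U), fun c => g ⟨ρ c, hmem c⟩, by simp, ?_, ?_⟩
  · exact Subtype.val_injective.comp g.symm.injective
  · intro x hx
    have hxD : x ∉ D := fun h => hx ⟨g ⟨x, h⟩, by simp⟩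
    have hxρ : x ∉ Set.range ρ := by
      rintro ⟨c, rfl⟩
      exact hxD (hmem c)
    have hsub : ∀ τ, ∀ y ∈ A τ, y ∈ D := fun τ y hy =>
      Finset.mem_union_right _ (Finset.mem_biUnion.2 ⟨τ, Finset.mem_univ _, hy⟩)
    obtain ⟨τ, hτ⟩ : ∃ τ, (fun R => s R fun _ => x) = τ := ⟨_, rfl⟩
    have hcard : (A τ).card = N :=
      (hA τ).resolve_left fun h => hxD (hsub τ x (h ⟨hxρ, hτ⟩))
    refine ⟨Finset.univ.filter fun i => (g.symm i : U) ∈ A τ, ?_, ?_⟩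
    · rw [← hcard]
      refine Finset.card_le_card_of_surjOn (fun i => (g.symm i : U)) fun y hy => ?_
      exact ⟨g ⟨y, hsub τ y hy⟩, by simpa using hy, by simp⟩
    · intro i hi
      obtain ⟨hy, hyτ⟩ := hAsub τ (Finset.mem_filter.1 hi).2
      intro _
      exact isAut_swap hS hxρ hy fun R => iff_of_eq (congrFun (hτ.trans hyτ.symm) R)

/-! ### Stabilization -/

/-- A decreasing sequence of subsets of a finite set, each of which determines the next one, is
constant from the cardinality of the set on. -/
theorem subset_of_card_of_antitone {α : Type*} [Finite α] {P : ℕ → Set α} (hP : Antitone P)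
    (hdet : ∀ n, P n = P (n + 1) → P (n + 1) = P (n + 2)) (n : ℕ) : P (Nat.card α) ⊆ P n := by
  obtain ⟨m, hm, heq⟩ : ∃ m ≤ Nat.card α, P m = P (m + 1) := by
    by_contra! H
    -- Otherwise the cardinality decreases strictly more often than it can.
    have key : ∀ n ≤ Nat.card α + 1, (P n).ncard + n ≤ Nat.card α := by
      intro n
      induction n with
      | zero => exact fun _ => Set.ncard_le_card _
      | succ n ih =>
        intro hn
        have hlt : (P (n + 1)).ncard < (P n).ncard :=
          Set.ncard_lt_ncard (((hP n.le_succ).ssubset_of_ne (H n (by omega)).symm)) (Set.toFinite _)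
        have := ih (by omega)
        omega
    have := key _ le_rfl
    omega
  have hstep : ∀ k, P (m + k) = P (m + k + 1) := by
    intro k
    induction k with
    | zero => exact heq
    | succ k ih => exact hdet _ ih
  have hconst : ∀ k, P (m + k) = P m := by
    intro k
    induction k with
    | zero => rfl
    | succ k ih => rw [← ih, hstep k]; rfl
  refine (hP hm).trans ?_
  rw [← hconst n]
  exact hP (by omega)

theorem Game.NoInput.Psi_antitone {G : Game} (hG : G.NoInput) {U : Type*}
    (ρ : Fin G.sig.numConst → U) :
    Antitone fun h => {p : G.Pos U | (G.Psi h p.1).IsTrue ρ p.2} :=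
  antitone_nat_of_succ_le fun h p hp => ((hG.holds_Psi_succ ρ p.2 h p.1).1 hp).1

/-- The set of positions that satisfy one weakest precondition determines that for the next one, in
the sense required by `subset_of_card_of_antitone`. -/
theorem Game.NoInput.Psi_det {G : Game} (hG : G.NoInput) {U : Type*}
    (ρ : Fin G.sig.numConst → U) (h : ℕ)
    (H : {p : G.Pos U | (G.Psi h p.1).IsTrue ρ p.2} = {p | (G.Psi (h + 1) p.1).IsTrue ρ p.2}) :
    {p : G.Pos U | (G.Psi (h + 1) p.1).IsTrue ρ p.2} = {p | (G.Psi (h + 2) p.1).IsTrue ρ p.2} := by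
  have H' : ∀ v s, (G.Psi h v).IsTrue ρ s ↔ (G.Psi (h + 1) v).IsTrue ρ s :=
    fun v s => Set.ext_iff.1 H (v, s)
  ext ⟨v, s⟩
  simp only [Set.mem_ofPred_eq]
  rw [hG.holds_Psi_succ ρ s h, hG.holds_Psi_succ ρ s (h + 1), H']
  simp only [← H']

theorem Game.card_pos_le {G : Game} (hG : G.IsMonadic) (m : ℕ) [NeZero m] :
    Finite (G.Pos (Fin m)) ∧ Nat.card (G.Pos (Fin m)) ≤ G.numV * 2 ^ (G.sig.numState * m) := by
  have hinj : Injective fun p : G.Pos (Fin m) =>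
      ((p.1, fun q => p.2 q.1 fun _ => q.2) :
        Fin G.numV × (Fin G.sig.numState × Fin m → Prop)) := by
    rintro ⟨v, s⟩ ⟨v', s'⟩ h
    simp only [Prod.mk.injEq] at h
    refine Prod.ext h.1 (funext fun R => funext fun t => ?_)
    obtain ⟨z, rfl⟩ := exists_eq_const (hG.1 R) t
    exact congrFun h.2 (R, z)
  exact ⟨Finite.of_injective _ hinj, (Nat.card_le_card_of_injective _ hinj).trans (by simp)⟩

/-- The bound on the size of cores, for the rank bound `N`. -/
def Game.coreBound (G : Game) (N : ℕ) : ℕ := G.sig.numConst + 2 ^ G.sig.numState * N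

/-- The number of iterations after which the weakest preconditions are stable. -/
def Game.stableBound (G : Game) (N : ℕ) : ℕ :=
  G.numV * 2 ^ (G.sig.numState * G.coreBound N)

theorem Game.Psi_of_stableBound_fin {G : Game} (hG : G.IsMonadic) (hG' : G.NoInput) {N m : ℕ}
    (hm : m ≤ G.coreBound N) [NeZero m] (ρ : Fin G.sig.numConst → Fin m) (s : State G.sig (Fin m))
    (v : Fin G.numV) (hv : (G.Psi (G.stableBound N) v).IsTrue ρ s) (h : ℕ) :
    (G.Psi h v).IsTrue ρ s := by
  obtain ⟨hfin, hcard⟩ := G.card_pos_le hG m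
  have hle : Nat.card (G.Pos (Fin m)) ≤ G.stableBound N :=
    hcard.trans (Nat.mul_le_mul_left _ (Nat.pow_le_pow_right two_pos (Nat.mul_le_mul_left _ hm)))
  have h1 := hG'.Psi_antitone ρ hle
  have h2 := subset_of_card_of_antitone (hG'.Psi_antitone ρ) (hG'.Psi_det ρ) h
  exact h2 (h1 (a := (v, s)) hv)

/-- An `N`-core with at least one element and at most `G.coreBound N` elements. -/
theorem Game.exists_isCore {G : Game} (hG : G.IsMonadic) {N : ℕ} (hN : N ≠ 0) {U : Type*}
    [Nonempty U] (ρ : Fin G.sig.numConst → U) (s : State G.sig U) :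
    ∃ m ≤ G.coreBound N, ∃ (_ : NeZero m) (f : Fin m → U) (ρ' : Fin G.sig.numConst → Fin m),
      (∀ c, f (ρ' c) = ρ c) ∧ IsCore N f ρ s := by
  obtain ⟨m, hm, f, ρ', hρ, hf⟩ := FOGame.exists_isCore hG.1 N ρ s
  refine ⟨m, hm, ⟨?_⟩, f, ρ', hρ, hf⟩
  rintro rfl
  -- An element outside of an empty core would be interchangeable with `N ≠ 0` elements of the core.
  obtain ⟨Y, hY, -⟩ := hf.exists_swap (Classical.arbitrary U) (by simp)
  rw [Finset.eq_empty_of_isEmpty Y] at hY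
  exact hN (by simpa using hY)

/-- If the iterated weakest precondition at stage `G.stableBound N` holds, then those of all stages
do, over arbitrary universes. -/
theorem Game.Psi_of_stableBound {G : Game} (hG : G.IsMonadic) (hG' : G.NoInput) {N : ℕ}
    (hN : N ≠ 0) (hGN : G.RankLE N) {U : Type*} [Nonempty U] (ρ : Fin G.sig.numConst → U)
    (s : State G.sig U) (v : Fin G.numV) (hv : (G.Psi (G.stableBound N) v).IsTrue ρ s) (h : ℕ) :
    (G.Psi h v).IsTrue ρ s := by
  obtain ⟨m, hm, _, f, ρ', hρ, hf⟩ := G.exists_isCore hG hN ρ s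
  rw [← hf.Psi_iff hG' hGN hρ] at hv ⊢
  exact Psi_of_stableBound_fin hG hG' hm ρ' _ v hv h

/-- Safety can be checked on the universes with at most `G.coreBound N` elements and on plays of
length at most `G.stableBound N`. -/
theorem Game.safe_iff_fin {G : Game} (hG : G.IsMonadic) (hG' : G.NoInput) {N : ℕ}
    (hN : N ≠ 0) (hGN : G.RankLE N) :
    Safe.{u} G ↔ ∀ m ≤ G.coreBound N, m ≠ 0 → ∀ (ρ : Fin G.sig.numConst → Fin m)
      (s : State G.sig (Fin m)), G.init.IsTrue ρ s → (G.Psi (G.stableBound N) G.start).IsTrue ρ s := by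
  rw [hG'.safe_iff]
  constructor
  · intro H m _ hm ρ s hs
    have : NeZero m := ⟨hm⟩
    -- The copy of `Fin m` in the universe level of the game.
    have hf := IsCore.of_bijective N (Equiv.ulift.{u} (α := Fin m)).bijective ρ s
    have hρ : ∀ c, Equiv.ulift.{u} (ULift.up (ρ c)) = ρ c := fun _ => rfl
    rw [← hf.init_iff hGN hρ] at hs
    rw [← hf.Psi_iff hG' hGN hρ]
    exact H _ _ _ hs _
  · intro H U _ ρ s hs
    refine Psi_of_stableBound hG hG' hN hGN ρ s G.start ?_
    obtain ⟨m, hm, hm0, f, ρ', hρ, hf⟩ := G.exists_isCore hG hN ρ s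
    rw [← hf.init_iff hGN hρ] at hs
    rw [← hf.Psi_iff hG' hGN hρ]
    exact H m hm hm0.out ρ' _ hs

/-! ### Bounds for games in terms of their codes -/

theorem encode_lt_encode_of_mem {α : Type*} [Encodable α] {a : α} {l : List α} (h : a ∈ l) :
    Encodable.encode a < Encodable.encode l := by
  induction l with
  | nil => simp at h
  | cons b l ih =>
    rw [Encodable.encode_list_cons, Nat.lt_succ_iff]
    rcases List.mem_cons.1 h with rfl | h
    exacts [Nat.left_le_pair _ _, (ih h).le.trans (Nat.right_le_pair _ _)]

theorem encode_fst_le {α β : Type*} [Encodable α] [Encodable β] (p : α × β) :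
    Encodable.encode p.1 ≤ Encodable.encode p :=
  Nat.left_le_pair _ _

theorem encode_snd_le {α β : Type*} [Encodable α] [Encodable β] (p : α × β) :
    Encodable.encode p.2 ≤ Encodable.encode p :=
  Nat.right_le_pair _ _

theorem Fml.rank_le_code {S : Signature} {Γ : List ℕ} {n : ℕ} (φ : Fml S Γ n) :
    φ.rank ≤ φ.code := by
  induction φ with
  | tru | state | pvar | eq => exact Nat.zero_le _
  | neg φ ih => exact (ih.trans (Nat.right_le_pair _ _)).trans (Nat.le_succ _)
  | and φ ψ ih₁ ih₂ =>
    refine le_trans ?_ ((Nat.right_le_pair _ _).trans (Nat.le_succ _))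
    exact max_le (ih₁.trans (Nat.left_le_pair _ _)) (ih₂.trans (Nat.right_le_pair _ _))
  | all φ ih => exact Nat.succ_le_succ (ih.trans (Nat.right_le_pair _ _))
  | allP r φ ih =>
    exact ((ih.trans (Nat.right_le_pair _ _)).trans (Nat.right_le_pair _ _)).trans (Nat.le_succ _)

/-- The Gödel number of the code of a monadic game bounds the ranks of its formulas, the successor
leaving room for the formal parameter of a substitution. -/
theorem Game.rankLE_code {G : Game} (hG : G.IsMonadic) :
    G.RankLE (Encodable.encode G.code + 1) := by
  have h1 := (encode_snd_le G.code)
  have h2 := (encode_snd_le G.code.2).trans h1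
  have h3 := (encode_snd_le G.code.2.2).trans h2
  have h4 := (encode_snd_le G.code.2.2.2).trans h3
  have h5 := (encode_snd_le G.code.2.2.2.2).trans h4
  have hE := (encode_fst_le G.code.2.2.2.2).trans h4
  refine ⟨fun e R => ?_, ?_, fun v => ?_⟩
  · refine add_le_add ?_ (hG.1 R)
    refine (Fml.rank_le_code _).trans (le_trans ?_ hE)
    have hmem : (G.edge e).code ∈ G.code.2.2.2.2.1 := List.mem_ofFn.2 ⟨e, rfl⟩
    refine le_trans ?_ (encode_lt_encode_of_mem hmem).le
    have e1 := encode_snd_le (G.edge e).code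
    have e2 := (encode_snd_le (G.edge e).code.2).trans e1
    have e3 := (encode_snd_le (G.edge e).code.2.2).trans e2
    refine le_trans ?_ ((encode_snd_le (G.edge e).code.2.2.2).trans e3)
    have hθ : ((G.edge e).θ R).code ∈ (G.edge e).code.2.2.2.2 := List.mem_ofFn.2 ⟨R, rfl⟩
    exact (encode_lt_encode_of_mem hθ).le
  · exact ((Fml.rank_le_code _).trans ((encode_fst_le G.code.2.2.2.2.2).trans h5)).trans
      (Nat.le_succ _)
  · have hmem : (G.I v).code ∈ G.code.2.2.2.2.2.2 := List.mem_ofFn.2 ⟨v, rfl⟩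
    exact ((Fml.rank_le_code _).trans ((encode_lt_encode_of_mem hmem).le.trans
      ((encode_snd_le G.code.2.2.2.2.2).trans h5))).trans (Nat.le_succ _)

/-! ### Evaluation of Gödel numbers in finite structures -/

/-- Codes of finite structures: the size `m` of the universe `Fin m`, the list of the values of the
constants, and the list of the truth values of the atoms `R x`, which is at the place `R * m + x`. The
truth value of a nullary `R` is at the place `R * m`, which is of use only for `m ≠ 0`. -/
abbrev StructCode : Type := ℕ × List ℕ × List Bool

/-- The value of the term with a given Gödel number. -/
def termVal (ρ env : List ℕ) (t : ℕ) : ℕ :=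
  if t % 2 = 0 then ρ.getD (t / 2) 0 else env.getD (t / 2) 0

/-- The value of the first term of the list with a given Gödel number, and `0` for the empty
list. -/
def argVal (ρ env : List ℕ) (c : ℕ) : ℕ :=
  if c = 0 then 0 else termVal ρ env (c - 1).unpair.1

/-- The instances of immediate subformulas on which the truth of a formula under an assignment
depends, for a universe of size `m`. -/
def subgoals (m : ℕ) (b : ℕ × List ℕ) : List (ℕ × List ℕ) :=
  if b.1 = 0 then []
  else if (b.1 - 1).unpair.1 = 3 then [((b.1 - 1).unpair.2, b.2)]
  else if (b.1 - 1).unpair.1 = 4 then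
    [((b.1 - 1).unpair.2.unpair.1, b.2), ((b.1 - 1).unpair.2.unpair.2, b.2)]
  else if (b.1 - 1).unpair.1 = 5 then
    (List.range m).map fun x => ((b.1 - 1).unpair.2, x :: b.2)
  else []

/-- The truth of a formula under an assignment, computed from the truth values `r` of its
`subgoals`. -/
def combine (d : StructCode) (b : ℕ × List ℕ) (r : List Bool) : Bool :=
  if b.1 = 0 then true
  else if (b.1 - 1).unpair.1 = 0 then
    d.2.2.getD ((b.1 - 1).unpair.2.unpair.1 * d.1 +
      argVal d.2.1 b.2 (b.1 - 1).unpair.2.unpair.2) false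
  else if (b.1 - 1).unpair.1 = 2 then
    termVal d.2.1 b.2 (b.1 - 1).unpair.2.unpair.1 == termVal d.2.1 b.2 (b.1 - 1).unpair.2.unpair.2
  else if (b.1 - 1).unpair.1 = 3 then !r.all id
  else r.all id

theorem lt_of_mem_subgoals {m : ℕ} {b b' : ℕ × List ℕ} (h : b' ∈ subgoals m b) : b'.1 < b.1 := by
  have hle := Nat.unpair_right_le (b.1 - 1)
  have h1 := Nat.unpair_left_le (b.1 - 1).unpair.2
  have h2 := Nat.unpair_right_le (b.1 - 1).unpair.2
  unfold subgoals at h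
  split_ifs at h
  · simp at h
  · rw [List.mem_singleton.1 h]
    change (b.1 - 1).unpair.2 < b.1
    omega
  · simp only [List.mem_cons, List.not_mem_nil, or_false] at h
    rcases h with rfl | rfl
    · change (b.1 - 1).unpair.2.unpair.1 < b.1
      omega
    · change (b.1 - 1).unpair.2.unpair.2 < b.1
      omega
  · obtain ⟨x, -, rfl⟩ := List.mem_map.1 h
    change (b.1 - 1).unpair.2 < b.1
    omega
  · simp at h

/-- The truth value of the formula with Gödel number `b.1` in the structure `d` under the assignment
`b.2`, which may be longer than necessary. Predicate variables and quantifiers over predicates are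
not taken into account. -/
def evalCode (d : StructCode) (b : ℕ × List ℕ) : Bool :=
  combine d b ((subgoals d.1 b).attach.map fun b' => evalCode d b'.1)
termination_by b.1
decreasing_by exact lt_of_mem_subgoals b'.2

theorem evalCode_eq (d : StructCode) (b : ℕ × List ℕ) :
    evalCode d b = combine d b ((subgoals d.1 b).map (evalCode d)) := by
  rw [evalCode, List.attach_map_val]

/-- The place of an argument tuple in the list of truth values of a predicate, see `StructCode`. -/
def argIdx {m r : ℕ} (t : Fin r → Fin m) : ℕ := if h : 0 < r then t ⟨0, h⟩ else 0

/-- The list `l` codes the valuation `v` of first-order variables or constants. -/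
def CodesVal {m n : ℕ} (l : List ℕ) (v : Fin n → Fin m) : Prop := ∀ i : Fin n, l.getD i 0 = v i

/-- The list `l` codes the state `s`. -/
def CodesState {S : Signature} {m : ℕ} (l : List Bool) (s : State S (Fin m)) : Prop :=
  ∀ (R : Fin S.numState) (t : Fin (S.arity R) → Fin m), l.getD (R * m + argIdx t) false = true ↔ s R t

theorem termVal_codeTm {S : Signature} {m n : ℕ} {ρl env : List ℕ} {ρ : Fin S.numConst → Fin m}
    {v : Fin n → Fin m} (hρ : CodesVal ρl ρ) (hv : CodesVal env v) (t : Tm S n) :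
    termVal ρl env (codeTm t) = (Sum.elim ρ v t : Fin m) := by
  cases t with
  | inl c => simpa [termVal, codeTm] using hρ c
  | inr i =>
    have h1 : (2 * (i : ℕ) + 1) % 2 ≠ 0 := by omega
    have h2 : (2 * (i : ℕ) + 1) / 2 = i := by omega
    simpa only [termVal, codeTm, h1, h2, if_false, Sum.elim_inr] using hv i

theorem argVal_codeTms {S : Signature} {m n r : ℕ} {ρl env : List ℕ} {ρ : Fin S.numConst → Fin m}
    {v : Fin n → Fin m} (hρ : CodesVal ρl ρ) (hv : CodesVal env v) (ts : Fin r → Tm S n) :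
    argVal ρl env (codeTms ts) = argIdx fun i => (Sum.elim ρ v (ts i) : Fin m) := by
  cases r with
  | zero => simp [argVal, codeTms, argIdx]
  | succ r =>
    simp only [codeTms, List.ofFn_succ, Encodable.encode_list_cons, argVal, argIdx,
      Nat.succ_ne_zero, if_false, Nat.succ_eq_add_one, Nat.add_sub_cancel, Nat.unpair_pair,
      Encodable.encode_nat, termVal_codeTm hρ hv]
    simp

/-- On Gödel numbers of first-order formulas, `evalCode` computes the truth value. -/
theorem evalCode_iff {S : Signature} {m : ℕ} {ρl : List ℕ} {sl : List Bool}
    {ρ : Fin S.numConst → Fin m} {s : State S (Fin m)} (hρ : CodesVal ρl ρ) (hs : CodesState sl s)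
    {Γ : List ℕ} {n : ℕ} (φ : Fml S Γ n) (hφ : φ.IsFO) (hΓ : Γ = []) (ω : PVal (Fin m) Γ)
    {env : List ℕ} {v : Fin n → Fin m} (hv : CodesVal env v) :
    evalCode (m, ρl, sl) (φ.code, env) = true ↔ φ.Holds ρ s ω v := by
  rw [evalCode_eq]
  induction φ generalizing env with
  | tru => simp [Fml.code, combine, Fml.Holds]
  | state R ts =>
    simp only [Fml.code, combine, Fml.Holds, Nat.add_sub_cancel, Nat.unpair_pair,
      Nat.add_one_ne_zero, if_false, if_true, argVal_codeTms hρ hv]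
    exact hs R _
  | pvar X ts => subst hΓ; nomatch X
  | eq t t' =>
    simp [Fml.code, combine, Fml.Holds, termVal_codeTm hρ hv, Fin.ext_iff]
  | neg φ ih =>
    have := ih hφ hΓ ω hv
    rw [← evalCode_eq] at this
    simp [Fml.code, combine, subgoals, Fml.Holds, ← this]
  | and φ ψ ih₁ ih₂ =>
    have h₁ := ih₁ hφ.1 hΓ ω hv
    have h₂ := ih₂ hφ.2 hΓ ω hv
    rw [← evalCode_eq] at h₁ h₂
    simp [Fml.code, combine, subgoals, Fml.Holds, ← h₁, ← h₂]
  | @all Γ n φ ih =>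
    have h : ∀ x : Fin m, evalCode (m, ρl, sl) (φ.code, (x : ℕ) :: env) = true ↔
        φ.Holds ρ s ω (Fin.cons x v) := fun x => by
      rw [evalCode_eq]
      refine ih hφ hΓ ω fun i => ?_
      refine Fin.cases ?_ (fun i => ?_) i
      · simp
      · simpa using hv i
    simp only [Fml.Holds, ← h]
    simp [Fml.code, combine, subgoals, Fin.forall_iff]
  | allP r φ ih => exact hφ.elim

/-! ### The decision procedure -/

/-- The truth values in the successor state along an edge whose substitution has the given Gödel
numbers. -/
def nextCode (d : StructCode) (θ : List ℕ) : List Bool :=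
  (List.range (θ.length * d.1)).map fun i => evalCode d (θ.getD (i / d.1) 0, [i % d.1])

theorem argIdx_lt {m r : ℕ} [NeZero m] (t : Fin r → Fin m) : argIdx t < m := by
  unfold argIdx
  split_ifs
  exacts [Fin.is_lt _, NeZero.pos m]

theorem place_lt {k m R a : ℕ} (hR : R < k) (ha : a < m) : R * m + a < k * m :=
  calc R * m + a < (R + 1) * m := by rw [Nat.add_mul, one_mul]; omega
    _ ≤ k * m := Nat.mul_le_mul_right _ hR

theorem place_div {m R a : ℕ} (ha : a < m) : (R * m + a) / m = R := by
  rw [mul_comm, Nat.mul_add_div (by omega), Nat.div_eq_of_lt ha, add_zero]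

theorem place_mod {m R a : ℕ} (ha : a < m) : (R * m + a) % m = a := by
  rw [mul_comm, Nat.mul_add_mod, Nat.mod_eq_of_lt ha]

theorem getD_map_range {α : Type*} {n i : ℕ} (hi : i < n) (f : ℕ → α) (d : α) :
    ((List.range n).map f).getD i d = f i := by
  simp [List.getD, hi]

/-- The code of the successor state. The environment consists of the argument of the atom alone; for
a nullary predicate its entry is superfluous and harmless. -/
theorem codesState_nextCode {S : Signature} (hS : ∀ R, S.arity R ≤ 1) {numV m : ℕ} [NeZero m]
    {e : Edge S numV} (he : e.input = none) {ρl : List ℕ} {sl : List Bool}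
    {ρ : Fin S.numConst → Fin m} {s : State S (Fin m)} (hρ : CodesVal ρl ρ)
    (hs : CodesState sl s) : CodesState (nextCode (m, ρl, sl) e.code.2.2.2.2) (e.succ ρ s) := by
  intro R t
  have hlt := place_lt R.is_lt (argIdx_lt t)
  have hv : CodesVal [argIdx t] t := by
    intro i
    have h0 : 0 < S.arity R := i.pos
    have hi : i = ⟨0, h0⟩ := Fin.ext (by have := hS R; omega)
    subst hi
    simp [argIdx, h0]
  refine Iff.trans (iff_of_eq ?_)
    (evalCode_iff hρ hs (e.θ R) (e.θ_isFO R) (by simp [he]) (fun _ _ _ => False) hv)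
  rw [nextCode, getD_map_range (by simpa [Edge.code] using hlt), place_div (argIdx_lt t),
    place_mod (argIdx_lt t)]
  simp [Edge.code, List.getD]

/-- The parameters of the iteration of weakest preconditions: the edges, the assertions, the size of
the universe and the values of the constants. -/
abbrev PsiCode : Type := List EdgeCode × List ℕ × ℕ × List ℕ

/-- The positions on which the truth of the next weakest precondition depends: the position itself
and its successors. -/
def succCodes (a : PsiCode) (p : ℕ × List Bool) : List (ℕ × List Bool) :=
  p :: a.1.flatMap fun e =>
    if e.1 = p.1 then [(e.2.1, nextCode (a.2.2.1, a.2.2.2, p.2) e.2.2.2.2)] else []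

/-- The truth value of the `h`-th iterated weakest precondition at a position. -/
def psiCode (a : PsiCode) : ℕ → ℕ × List Bool → Bool
  | 0, p => evalCode (a.2.2.1, a.2.2.2, p.2) (a.2.1.getD p.1 0, [])
  | h + 1, p => (succCodes a p).all (psiCode a h)

theorem psiCode_iff {G : Game} (hG : G.IsMonadic) (hG' : G.NoInput) {m : ℕ} [NeZero m]
    {ρl : List ℕ} {ρ : Fin G.sig.numConst → Fin m} (hρ : CodesVal ρl ρ) (h : ℕ)
    {sl : List Bool} {s : State G.sig (Fin m)} (hs : CodesState sl s) (v : Fin G.numV) :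
    psiCode (G.code.2.2.2.2.1, G.code.2.2.2.2.2.2, m, ρl) h ((v : ℕ), sl) = true ↔
      (G.Psi h v).IsTrue ρ s := by
  induction h generalizing sl s v with
  | zero =>
    refine Iff.trans (iff_of_eq ?_) (evalCode_iff hρ hs (G.I v) (G.I_isFO v) rfl PVal.nil
      (env := []) (v := Fin.elim0) fun i => i.elim0)
    simp [psiCode, Game.code, List.getD]
  | succ h ih =>
    rw [hG'.holds_Psi_succ, psiCode, succCodes, List.all_cons, Bool.and_eq_true, ih hs]
    refine and_congr_right fun _ => ?_
    have hnext := fun e => codesState_nextCode hG.1 (hG' e) hρ hs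
    simp only [← fun e => ih (hnext e) (G.edge e).tgt]
    simp only [Game.code, List.all_eq_true, List.mem_flatMap, List.mem_ofFn]
    constructor
    · rintro H e rfl
      refine H _ ⟨_, ⟨e, rfl⟩, ?_⟩
      simp [Edge.code]
    · rintro H p ⟨_, ⟨e, rfl⟩, hp⟩
      split_ifs at hp with hsrc
      · rw [List.mem_singleton.1 hp]
        exact H e (Fin.ext hsrc)
      · simp at hp

/-- The lists of length `n` with entries from `A`. -/
def listsOf {α : Type*} (A : List α) : ℕ → List (List α)
  | 0 => [[]]
  | n + 1 => (listsOf A n).flatMap fun l => A.map fun x => x :: l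

theorem mem_listsOf {α : Type*} {A : List α} {n : ℕ} {l : List α} :
    l ∈ listsOf A n ↔ l.length = n ∧ ∀ x ∈ l, x ∈ A := by
  induction n generalizing l with
  | zero =>
    simp only [listsOf, List.mem_singleton, List.length_eq_zero_iff]
    constructor
    · rintro rfl
      simp
    · exact fun h => h.1
  | succ n ih =>
    simp only [listsOf, List.mem_flatMap, List.mem_map, ih]
    constructor
    · rintro ⟨l, ⟨rfl, hl⟩, x, hx, rfl⟩
      simpa [hx] using hl
    · rintro ⟨hlen, hl⟩
      cases l with
      | nil => simp at hlen
      | cons x l =>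
        simp only [List.length_cons, Nat.add_right_cancel_iff] at hlen
        exact ⟨l, ⟨hlen, fun y hy => hl y (List.mem_cons_of_mem _ hy)⟩, x, hl x List.mem_cons_self,
          rfl⟩

/-- Whether the structure with universe `Fin m`, constants `ρ` and state `s` does not satisfy the
initial condition or satisfies the `h`-th iterated weakest precondition at the start. -/
def checkStruct (c : GameCode) (h m : ℕ) (ρ : List ℕ) (s : List Bool) : Bool :=
  !evalCode (m, ρ, s) (c.2.2.2.2.2.1, []) ||
    psiCode (c.2.2.2.2.1, c.2.2.2.2.2.2, m, ρ) h (c.2.2.2.1, s)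

/-- Whether all structures with universe `Fin m` and constants `ρ` pass `checkStruct`. -/
def checkStates (c : GameCode) (h m : ℕ) (ρ : List ℕ) : Bool :=
  (listsOf [true, false] (c.1.length * m)).all fun s => checkStruct c h m ρ s

/-- Whether all structures with universe `Fin m` pass `checkStruct`. -/
def checkSize (c : GameCode) (h m : ℕ) : Bool :=
  (listsOf (List.range m) c.2.1).all fun ρ => checkStates c h m ρ

/-- Whether all non-empty structures of size at most `M` pass `checkStruct`. -/
def checkUpTo (c : GameCode) (h M : ℕ) : Bool :=
  (List.range (M + 1)).all fun m => m == 0 || checkSize c h m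

/-- `Game.coreBound` for a rank bound which depends on the code alone. -/
def coreBoundCode (c : GameCode) : ℕ := c.2.1 + 2 ^ c.1.length * (Encodable.encode c + 1)

/-- `Game.stableBound` for the rank bound of `coreBoundCode`. -/
def stableBoundCode (c : GameCode) : ℕ := c.2.2.1 * 2 ^ (c.1.length * coreBoundCode c)

/-- The decision procedure for safety. -/
def decideSafe (c : GameCode) : Bool := checkUpTo c (stableBoundCode c) (coreBoundCode c)

theorem checkStruct_iff {G : Game} (hG : G.IsMonadic) (hG' : G.NoInput) {m : ℕ} [NeZero m]
    {ρl : List ℕ} {ρ : Fin G.sig.numConst → Fin m} (hρ : CodesVal ρl ρ) (h : ℕ)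
    {sl : List Bool} {s : State G.sig (Fin m)} (hs : CodesState sl s) :
    checkStruct G.code h m ρl sl = true ↔ (G.init.IsTrue ρ s → (G.Psi h G.start).IsTrue ρ s) := by
  have hinit : _ ↔ G.init.IsTrue ρ s := evalCode_iff hρ hs G.init G.init_isFO rfl PVal.nil
    (env := []) (v := Fin.elim0) fun i => i.elim0
  rw [← psiCode_iff hG hG' hρ h hs, ← hinit, checkStruct, Bool.or_eq_true, Bool.not_eq_true',
    ← Bool.not_eq_true, ← imp_iff_not_or]
  rfl

theorem exists_codesVal {m n : ℕ} (v : Fin n → Fin m) :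
    ∃ l ∈ listsOf (List.range m) n, CodesVal l v := by
  refine ⟨List.ofFn fun i => (v i : ℕ), mem_listsOf.2 ⟨by simp, ?_⟩, fun i => by simp [List.getD]⟩
  simp [List.mem_ofFn]

theorem exists_val_of_mem {m n : ℕ} {l : List ℕ} (hl : l ∈ listsOf (List.range m) n) :
    ∃ v : Fin n → Fin m, CodesVal l v := by
  obtain ⟨rfl, hmem⟩ := mem_listsOf.1 hl
  refine ⟨fun i => ⟨l[i], List.mem_range.1 (hmem _ (List.getElem_mem _))⟩, fun i => ?_⟩
  simp

theorem exists_codesState {S : Signature} (hS : ∀ R, S.arity R ≤ 1) {m : ℕ} [NeZero m]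
    (s : State S (Fin m)) :
    ∃ l ∈ listsOf [true, false] (S.numState * m), CodesState l s := by
  classical
  refine ⟨(List.range (S.numState * m)).map fun i => if h : i / m < S.numState then
    decide (s ⟨i / m, h⟩ fun _ => Fin.ofNat m (i % m)) else false,
    mem_listsOf.2 ⟨by simp, by simp⟩, fun R t => ?_⟩
  have ht : (fun _ => Fin.ofNat m (argIdx t)) = t := by
    funext i
    have h0 : 0 < S.arity R := i.pos
    have hi : i = ⟨0, h0⟩ := Fin.ext (by have := hS R; omega)
    subst hi
    simp [argIdx, h0]
  have hdiv : ∀ q (h : q < S.numState), q = R →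
      ((s ⟨q, h⟩ fun _ => Fin.ofNat m (argIdx t)) ↔ s R t) := by
    rintro q h rfl
    exact iff_of_eq (congrArg (s R) ht)
  have := hdiv _ (by rw [place_div (argIdx_lt t)]; exact R.is_lt) (place_div (argIdx_lt t))
  rw [← this, getD_map_range (place_lt R.is_lt (argIdx_lt t)), place_mod (argIdx_lt t),
    dif_pos (by rw [place_div (argIdx_lt t)]; exact R.is_lt), decide_eq_true_eq]

theorem checkUpTo_iff {G : Game} (hG : G.IsMonadic) (hG' : G.NoInput) (h M : ℕ) :
    checkUpTo G.code h M = true ↔ ∀ m ≤ M, m ≠ 0 → ∀ (ρ : Fin G.sig.numConst → Fin m)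
      (s : State G.sig (Fin m)), G.init.IsTrue ρ s → (G.Psi h G.start).IsTrue ρ s := by
  simp only [checkUpTo, checkSize, checkStates, List.all_eq_true, List.mem_range, Nat.lt_succ_iff, Bool.or_eq_true,
    beq_iff_eq, or_iff_not_imp_left]
  refine forall₂_congr fun m _ => forall_congr' fun hm => ?_
  have : NeZero m := ⟨hm⟩
  have hk : G.code.1.length = G.sig.numState := by simp [Game.code]
  rw [hk]
  constructor
  · intro H ρ s
    obtain ⟨ρl, hρl, hρ⟩ := exists_codesVal ρ
    obtain ⟨sl, hsl, hs⟩ := exists_codesState hG.1 s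
    exact (checkStruct_iff hG hG' hρ h hs).1 (H ρl hρl sl hsl)
  · intro H ρl hρl sl _
    obtain ⟨ρ, hρ⟩ := exists_val_of_mem hρl
    exact (checkStruct_iff hG hG' hρ h (s := fun (R : Fin G.sig.numState) t => sl.getD (R * m + argIdx t) false = true)
      fun _ _ => Iff.rfl).2 (H ρ _)

theorem decideSafe_iff {G : Game} (hG : G.IsMonadic) (hG' : G.NoInput) :
    decideSafe G.code = true ↔ Game.Safe.{u} G := by
  have hM : coreBoundCode G.code = G.coreBound (Encodable.encode G.code + 1) := by
    simp [coreBoundCode, Game.coreBound, Game.code]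
  have hH : stableBoundCode G.code = G.stableBound (Encodable.encode G.code + 1) := by
    rw [stableBoundCode, hM]
    simp [Game.stableBound, Game.code]
  rw [decideSafe, hM, hH, checkUpTo_iff hG hG',
    Game.safe_iff_fin hG hG' (Nat.succ_ne_zero _) (Game.rankLE_code hG)]

/-! ### Computability of the decision procedure -/

theorem primrec_list_all {α β : Type*} [Primcodable α] [Primcodable β] {f : α → List β}
    {g : α → β → Bool} (hf : Primrec f) (hg : Primrec₂ g) :
    Primrec fun a => (f a).all (g a) :=
  (Primrec.list_foldr hf (Primrec.const true) (Primrec.and.comp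
    (hg.comp Primrec.fst (Primrec.fst.comp Primrec.snd))
    (Primrec.snd.comp Primrec.snd)).to₂).of_eq fun a => by
      induction f a with
      | nil => rfl
      | cons b l ih => simp [ih]

theorem primrec_two_pow {α : Type*} [Primcodable α] {f : α → ℕ} (hf : Primrec f) :
    Primrec fun a => 2 ^ f a :=
  (Primrec₂.unpaired'.1 Nat.Primrec.pow).comp (Primrec.const 2) hf

section Components

variable {α : Type*} [Primcodable α]

theorem primrec_unpair_fst {f : α → ℕ} (hf : Primrec f) : Primrec fun a => (f a).unpair.1 :=
  Primrec.fst.comp (Primrec.unpair.comp hf)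

theorem primrec_unpair_snd {f : α → ℕ} (hf : Primrec f) : Primrec fun a => (f a).unpair.2 :=
  Primrec.snd.comp (Primrec.unpair.comp hf)

theorem primrec_termVal {ρ env : α → List ℕ} {t : α → ℕ} (hρ : Primrec ρ) (henv : Primrec env)
    (ht : Primrec t) : Primrec fun a => termVal (ρ a) (env a) (t a) :=
  have h2 := Primrec.nat_div.comp ht (Primrec.const 2)
  Primrec.ite (Primrec.eq.comp (Primrec.nat_mod.comp ht (Primrec.const 2)) (Primrec.const 0))
    ((Primrec.list_getD 0).comp hρ h2) ((Primrec.list_getD 0).comp henv h2)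

theorem primrec_argVal {ρ env : α → List ℕ} {c : α → ℕ} (hρ : Primrec ρ) (henv : Primrec env)
    (hc : Primrec c) : Primrec fun a => argVal (ρ a) (env a) (c a) :=
  Primrec.ite (Primrec.eq.comp hc (Primrec.const 0)) (Primrec.const 0)
    (primrec_termVal hρ henv
      (primrec_unpair_fst (Primrec.nat_sub.comp hc (Primrec.const 1))))

end Components

theorem primrec_subgoals : Primrec₂ subgoals := by
  have hb : Primrec fun p : ℕ × ℕ × List ℕ => p.2.1 := Primrec.fst.comp Primrec.snd
  have henv : Primrec fun p : ℕ × ℕ × List ℕ => p.2.2 := Primrec.snd.comp Primrec.snd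
  have hb1 := Primrec.nat_sub.comp hb (Primrec.const 1)
  have htag := primrec_unpair_fst hb1
  have harg := primrec_unpair_snd hb1
  have hnil : Primrec fun _ : ℕ × ℕ × List ℕ => ([] : List (ℕ × List ℕ)) := Primrec.const []
  have hsing := fun {f : ℕ × ℕ × List ℕ → ℕ} (hf : Primrec f) => Primrec.pair hf henv
  refine Primrec.ite (Primrec.eq.comp hb (Primrec.const 0)) hnil ?_
  refine Primrec.ite (Primrec.eq.comp htag (Primrec.const 3))
    (Primrec.list_cons.comp (hsing harg) hnil) ?_
  refine Primrec.ite (Primrec.eq.comp htag (Primrec.const 4))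
    (Primrec.list_cons.comp (hsing (primrec_unpair_fst harg))
      (Primrec.list_cons.comp (hsing (primrec_unpair_snd harg)) hnil)) ?_
  refine Primrec.ite (Primrec.eq.comp htag (Primrec.const 5)) ?_ hnil
  exact Primrec.list_map (Primrec.list_range.comp Primrec.fst)
    (Primrec.pair (harg.comp Primrec.fst)
      (Primrec.list_cons.comp Primrec.snd (henv.comp Primrec.fst))).to₂

theorem primrec_combine :
    Primrec₂ fun (d : StructCode) (q : (ℕ × List ℕ) × List Bool) => combine d q.1 q.2 := by
  let T := StructCode × (ℕ × List ℕ) × List Bool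
  have hm : Primrec fun p : T => p.1.1 := Primrec.fst.comp Primrec.fst
  have hρ : Primrec fun p : T => p.1.2.1 := Primrec.fst.comp (Primrec.snd.comp Primrec.fst)
  have hs : Primrec fun p : T => p.1.2.2 := Primrec.snd.comp (Primrec.snd.comp Primrec.fst)
  have hb : Primrec fun p : T => p.2.1.1 := Primrec.fst.comp (Primrec.fst.comp Primrec.snd)
  have henv : Primrec fun p : T => p.2.1.2 := Primrec.snd.comp (Primrec.fst.comp Primrec.snd)
  have hr : Primrec fun p : T => p.2.2 := Primrec.snd.comp Primrec.snd
  have hb1 := Primrec.nat_sub.comp hb (Primrec.const 1)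
  have htag := primrec_unpair_fst hb1
  have harg := primrec_unpair_snd hb1
  have harg1 := primrec_unpair_fst harg
  have harg2 := primrec_unpair_snd harg
  have hall : Primrec fun p : T => p.2.2.all id := primrec_list_all hr Primrec₂.right
  refine Primrec.ite (Primrec.eq.comp hb (Primrec.const 0)) (Primrec.const true) ?_
  refine Primrec.ite (Primrec.eq.comp htag (Primrec.const 0))
    ((Primrec.list_getD false).comp hs (Primrec.nat_add.comp (Primrec.nat_mul.comp harg1 hm)
      (primrec_argVal hρ henv harg2))) ?_
  refine Primrec.ite (Primrec.eq.comp htag (Primrec.const 2))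
    (Primrec.beq.comp (primrec_termVal hρ henv harg1) (primrec_termVal hρ henv harg2)) ?_
  exact Primrec.ite (Primrec.eq.comp htag (Primrec.const 3)) (Primrec.not.comp hall) hall

theorem primrec_evalCode : Primrec₂ evalCode := by
  refine Primrec.nat_omega_rec evalCode (m := fun _ b => b.1) (l := fun d b => subgoals d.1 b)
    (g := fun d q => some (combine d q.1 q.2)) ?_ ?_ ?_ ?_ ?_
  · exact Primrec.fst.comp Primrec.snd
  · exact primrec_subgoals.comp (Primrec.fst.comp Primrec.fst) Primrec.snd
  · exact Primrec.option_some.comp primrec_combine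
  · exact fun d b b' => lt_of_mem_subgoals
  · exact fun d b => congrArg some (evalCode_eq d b).symm

theorem primrec_nextCode : Primrec₂ nextCode := by
  have hd : Primrec fun p : (StructCode × List ℕ) × ℕ => p.1.1 := Primrec.fst.comp Primrec.fst
  have hm := Primrec.fst.comp hd
  have hθ : Primrec fun p : (StructCode × List ℕ) × ℕ => p.1.2 := Primrec.snd.comp Primrec.fst
  refine Primrec.list_map (Primrec.list_range.comp (Primrec.nat_mul.comp
    (Primrec.list_length.comp Primrec.snd) (Primrec.fst.comp Primrec.fst))) ?_
  exact primrec_evalCode.comp hd (Primrec.pair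
    ((Primrec.list_getD 0).comp hθ (Primrec.nat_div.comp Primrec.snd hm))
    (Primrec.list_cons.comp (Primrec.nat_mod.comp Primrec.snd hm) (Primrec.const [])))

theorem primrec_succCodes : Primrec₂ succCodes := by
  refine Primrec.list_cons.comp Primrec.snd
    (Primrec.list_flatMap (Primrec.fst.comp Primrec.fst) ?_)
  let T := (PsiCode × ℕ × List Bool) × EdgeCode
  have ha : Primrec fun p : T => p.1.1 := Primrec.fst.comp Primrec.fst
  have hp : Primrec fun p : T => p.1.2 := Primrec.snd.comp Primrec.fst
  have he : Primrec fun p : T => p.2 := Primrec.snd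
  have he1 := Primrec.snd.comp he
  have hd : Primrec fun p : T => (p.1.1.2.2.1, p.1.1.2.2.2, p.1.2.2) :=
    Primrec.pair (Primrec.fst.comp (Primrec.snd.comp (Primrec.snd.comp ha)))
      (Primrec.pair (Primrec.snd.comp (Primrec.snd.comp (Primrec.snd.comp ha)))
        (Primrec.snd.comp hp))
  exact Primrec.ite (Primrec.eq.comp (Primrec.fst.comp he) (Primrec.fst.comp hp))
    (Primrec.list_cons.comp (Primrec.pair (Primrec.fst.comp he1)
      (primrec_nextCode.comp hd
        (Primrec.snd.comp (Primrec.snd.comp (Primrec.snd.comp he1))))) (Primrec.const []))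
    (Primrec.const [])

theorem primrec_psiCode :
    Primrec₂ fun (a : PsiCode) (b : ℕ × ℕ × List Bool) => psiCode a b.1 b.2 := by
  refine Primrec.nat_omega_rec (fun (a : PsiCode) (b : ℕ × ℕ × List Bool) => psiCode a b.1 b.2)
    (m := fun _ b => b.1)
    -- The position varies in the recursion on the stage, so the recursion is along the successors.
    (l := fun a b => Nat.casesOn b.1 [] fun h => (succCodes a b.2).map fun p => (h, p))
    (g := fun a q => some (Nat.casesOn q.1.1
      (evalCode (a.2.2.1, a.2.2.2, q.1.2.2) (a.2.1.getD q.1.2.1 0, [])) fun _ => q.2.all id))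
    ?_ ?_ ?_ ?_ ?_
  · exact Primrec.fst.comp Primrec.snd
  · refine Primrec.nat_casesOn (Primrec.fst.comp Primrec.snd) (Primrec.const []) ?_
    refine Primrec.list_map (primrec_succCodes.comp (Primrec.fst.comp Primrec.fst)
      (Primrec.snd.comp (Primrec.snd.comp Primrec.fst))) ?_
    exact Primrec.pair (Primrec.snd.comp Primrec.fst) Primrec.snd
  · let T := PsiCode × (ℕ × ℕ × List Bool) × List Bool
    have ha : Primrec fun p : T => p.1 := Primrec.fst
    have ha2 := Primrec.snd.comp (Primrec.snd.comp ha)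
    have hb : Primrec fun p : T => p.2.1 := Primrec.fst.comp Primrec.snd
    have hp := Primrec.snd.comp hb
    refine Primrec.option_some.comp (Primrec.nat_casesOn (Primrec.fst.comp hb) ?_ ?_)
    · exact primrec_evalCode.comp
        (Primrec.pair (Primrec.fst.comp ha2)
          (Primrec.pair (Primrec.snd.comp ha2) (Primrec.snd.comp hp)))
        (Primrec.pair ((Primrec.list_getD 0).comp (Primrec.fst.comp (Primrec.snd.comp ha))
          (Primrec.fst.comp hp)) (Primrec.const []))
    · exact (primrec_list_all (Primrec.snd.comp Primrec.snd) Primrec₂.right).comp Primrec.fst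
  · rintro a ⟨_ | h, p⟩ b' hb'
    · simp at hb'
    · obtain ⟨q, -, rfl⟩ := List.mem_map.1 hb'
      exact Nat.lt_succ_self h
  · rintro a ⟨_ | h, p⟩
    · rfl
    · simp [psiCode, List.all_map, Function.comp_def]

theorem primrec_listsOf {α : Type*} [Primcodable α] :
    Primrec₂ (listsOf : List α → ℕ → List (List α)) := by
  have h : Primrec₂ fun (A : List α) (q : ℕ × List (List α)) =>
      q.2.flatMap fun l => A.map fun x => x :: l := by
    refine Primrec.list_flatMap (Primrec.snd.comp Primrec.snd) ?_
    refine Primrec.list_map (Primrec.fst.comp Primrec.fst) ?_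
    exact Primrec.list_cons.comp Primrec.snd (Primrec.snd.comp Primrec.fst)
  refine (Primrec.nat_rec (Primrec.const [[]]) h).of_eq fun A n => ?_
  induction n with
  | zero => rfl
  | succ n ih => simp only [listsOf, ← ih]

theorem primrec_checkStruct :
    Primrec fun p : (GameCode × ℕ) × ℕ × List ℕ × List Bool =>
      checkStruct p.1.1 p.1.2 p.2.1 p.2.2.1 p.2.2.2 := by
  let T := (GameCode × ℕ) × ℕ × List ℕ × List Bool
  have hc : Primrec fun p : T => p.1.1.2.2.2 := Primrec.snd.comp (Primrec.snd.comp
    (Primrec.snd.comp (Primrec.fst.comp Primrec.fst)))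
  have hc1 := Primrec.snd.comp hc
  have hc2 := Primrec.snd.comp hc1
  have hh : Primrec fun p : T => p.1.2 := Primrec.snd.comp Primrec.fst
  have hd : Primrec fun p : T => p.2 := Primrec.snd
  have hs := Primrec.snd.comp (Primrec.snd.comp hd)
  refine Primrec.or.comp (Primrec.not.comp (primrec_evalCode.comp hd
    (Primrec.pair (Primrec.fst.comp hc2) (Primrec.const [])))) ?_
  exact primrec_psiCode.comp
    (Primrec.pair (Primrec.fst.comp hc1) (Primrec.pair (Primrec.snd.comp hc2)
      (Primrec.pair (Primrec.fst.comp hd) (Primrec.fst.comp (Primrec.snd.comp hd)))))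
    (Primrec.pair hh (Primrec.pair (Primrec.fst.comp hc) hs))

theorem primrec_checkStates :
    Primrec fun p : (GameCode × ℕ) × ℕ × List ℕ => checkStates p.1.1 p.1.2 p.2.1 p.2.2 := by
  have hc : Primrec fun p : (GameCode × ℕ) × ℕ × List ℕ => p.1.1 := Primrec.fst.comp Primrec.fst
  have hm : Primrec fun p : (GameCode × ℕ) × ℕ × List ℕ => p.2.1 := Primrec.fst.comp Primrec.snd
  have hρ : Primrec fun p : (GameCode × ℕ) × ℕ × List ℕ => p.2.2 := Primrec.snd.comp Primrec.snd
  have hlist := primrec_listsOf.comp (Primrec.const [true, false])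
    (Primrec.nat_mul.comp (Primrec.list_length.comp (Primrec.fst.comp hc)) hm)
  have hbody : Primrec₂ fun (p : (GameCode × ℕ) × ℕ × List ℕ) (s : List Bool) =>
      checkStruct p.1.1 p.1.2 p.2.1 p.2.2 s := by
    have h := primrec_checkStruct.comp (Primrec.pair (Primrec.fst.comp Primrec.fst)
      (Primrec.pair (hm.comp Primrec.fst) (Primrec.pair (hρ.comp Primrec.fst)
        (Primrec.snd (α := (GameCode × ℕ) × ℕ × List ℕ) (β := List Bool)))))
    exact h
  exact primrec_list_all hlist hbody

theorem primrec_checkSize :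
    Primrec fun p : (GameCode × ℕ) × ℕ => checkSize p.1.1 p.1.2 p.2 := by
  have hc : Primrec fun p : (GameCode × ℕ) × ℕ => p.1.1 := Primrec.fst.comp Primrec.fst
  have hlist := primrec_listsOf.comp (Primrec.list_range.comp Primrec.snd)
    (Primrec.fst.comp (Primrec.snd.comp hc))
  have hbody : Primrec₂ fun (p : (GameCode × ℕ) × ℕ) (ρ : List ℕ) =>
      checkStates p.1.1 p.1.2 p.2 ρ := by
    have h := primrec_checkStates.comp (Primrec.pair (Primrec.fst.comp Primrec.fst)
      (Primrec.pair (Primrec.snd.comp Primrec.fst)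
        (Primrec.snd (α := (GameCode × ℕ) × ℕ) (β := List ℕ))))
    exact h
  exact primrec_list_all hlist hbody

theorem primrec_checkUpTo : Primrec₂ fun (q : GameCode × ℕ) M => checkUpTo q.1 q.2 M := by
  have hbody : Primrec₂ fun (p : (GameCode × ℕ) × ℕ) (m : ℕ) =>
      (m == 0 || checkSize p.1.1 p.1.2 m) := by
    have h := primrec_checkSize.comp (Primrec.pair (Primrec.fst.comp Primrec.fst)
      (Primrec.snd (α := (GameCode × ℕ) × ℕ) (β := ℕ)))
    exact Primrec.or.comp (Primrec.beq.comp Primrec.snd (Primrec.const 0)) h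
  exact primrec_list_all (Primrec.list_range.comp (Primrec.succ.comp Primrec.snd)) hbody

theorem primrec_coreBoundCode : Primrec coreBoundCode :=
  Primrec.nat_add.comp (Primrec.fst.comp Primrec.snd) (Primrec.nat_mul.comp
    (primrec_two_pow (Primrec.list_length.comp Primrec.fst)) (Primrec.succ.comp Primrec.encode))

theorem primrec_stableBoundCode : Primrec stableBoundCode :=
  Primrec.nat_mul.comp (Primrec.fst.comp (Primrec.snd.comp Primrec.snd)) (primrec_two_pow
    (Primrec.nat_mul.comp (Primrec.list_length.comp Primrec.fst) primrec_coreBoundCode))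

theorem primrec_decideSafe : Primrec decideSafe :=
  primrec_checkUpTo.comp (Primrec.pair Primrec.id primrec_stableBoundCode) primrec_coreBoundCode

end FOGame

theorem mainTheorem3 :
    (∀ G : FOGame.Game, G.IsMonadic →
      G.NoInputOf FOGame.Player.A → G.NoInputOf FOGame.Player.B →
      ∃ h : ℕ, ∀ v : Fin G.numV, FOGame.Equivalent.{u} (G.Psi h v) (G.Psi (h + 1) v)) ∧
    ∃ f : FOGame.GameCode → Bool, Computable f ∧
      ∀ G : FOGame.Game, G.IsMonadic →
        G.NoInputOf FOGame.Player.A → G.NoInputOf FOGame.Player.B →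
        (f G.code = true ↔ FOGame.Game.Safe.{u} G) := by
  refine ⟨fun G hG hA hB => ?_, FOGame.decideSafe, FOGame.primrec_decideSafe.to_comp,
    fun G hG hA hB => FOGame.decideSafe_iff hG (FOGame.Game.noInput_of_noInputOf hA hB)⟩
  have hG' := FOGame.Game.noInput_of_noInputOf hA hB
  refine ⟨G.stableBound (Encodable.encode G.code + 1), fun v U _ ρ s => ⟨fun hv => ?_, fun hv => ?_⟩⟩
  · exact FOGame.Game.Psi_of_stableBound hG hG' (Nat.succ_ne_zero _)
      (FOGame.Game.rankLE_code hG) ρ s v hv _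
  · exact ((hG'.holds_Psi_succ ρ s _ v).1 hv).1
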